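/- Let $L\ge 1$, let $n_0,\dots,n_L$ be natural numbers, let $R\in\mathbb R^{n_L\times n_0}$ be a nonzero matrix, and let $x_1,\dots,x_N\in\mathbb R^{n_0}$ satisfy $\frac1N\sum_{i=1}^N x_ix_i^\top=I$. Consider gradient descent with constant step size $\delta>0$, $$\theta[k+1]=\theta[k]-\delta\,\nabla f(\theta[k]),\qquad \theta=(W_1,\dots,W_L),\quad W_j\in\mathbb R^{n_j\times n_{j-1}},$$ on the training cost of the deep linear network $$f(W_1,\dots,W_L)=\frac1{2N}\sum_{i=1}^N\bigl\|Rx_i-W_LW_{L-1}\cdots W_1x_i\bigr\|_2^2 ,$$ and let the initial point $\theta[0]$ be random, drawn from any probability distribution on the parameter space that is absolutely continuous with respect to Lebesgue measure. Then almost surely the following holds: if the iterates $\theta[k]$ converge to a point $(\hat W_1,\dots,\hat W_L)$, then $$\delta\le\frac{2}{\sum_{j=1}^{L}p_{j-1}^2\,q_{j+1}^2},\qquad p_j=\bigl\|\hat W_j\cdots\hat W_2\hat W_1v\bigr\|_2,\quad q_j=\bigl\|u^\top\hat W_L\hat W_{L-1}\cdots\hat W_j\bigr\|_2,$$ with $p_0=\|v\|_2=1$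 and $q_{L+1}=\|u\|_2=1$, for every pair of unit left and right singular vectors $u,v$ of $\hat R=\hat W_L\cdots\hat W_1$ corresponding to its largest singular value $\sigma$ (that is, $\hat Rv=\sigma u$ and $\hat R^\top u=\sigma v$). If the sum in the denominator is zero, which can happen only if $\hat R=0$, the bound is read as void. -/

import Mathlib

open MeasureTheory Filter Topology

namespace DeepLinear

noncomputable section

/-- Parameters of a deep linear network with `L` layers and widths `n 0, …, n L`: one real number
for every entry of every weight matrix, as one Euclidean space. -/
abbrev Params {L : ℕ} (n : Fin (L + 1) → ℕ) : Type :=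
  EuclideanSpace ℝ (Σ j : Fin L, Fin (n j.succ) × Fin (n j.castSucc))

variable {L : ℕ} {n : Fin (L + 1) → ℕ}

/-- The weight matrix of layer `j + 1` (layers are numbered from `1`, `j` from `0`), of size
`n (j + 1) × n j`. -/
def weight (θ : Params n) (j : Fin L) : Matrix (Fin (n j.succ)) (Fin (n j.castSucc)) ℝ :=
  Matrix.of fun a b => θ ⟨j, a, b⟩

/-- `below θ j = W_j ⋯ W_1`, the product of the first `j` layers; `below θ 0 = 1`. -/
def below (θ : Params n) (j : Fin (L + 1)) : Matrix (Fin (n j)) (Fin (n 0)) ℝ :=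
  Fin.induction (motive := fun j => Matrix (Fin (n j)) (Fin (n 0)) ℝ)
    1 (fun j P => weight θ j * P) j

/-- `above θ j = W_L ⋯ W_{j+1}`, the product of the layers after the `j`-th; `above θ L = 1`. -/
def above (θ : Params n) (j : Fin (L + 1)) : Matrix (Fin (n (Fin.last L))) (Fin (n j)) ℝ :=
  Fin.reverseInduction (motive := fun j => Matrix (Fin (n (Fin.last L))) (Fin (n j)) ℝ)
    1 (fun j Q => Q * weight θ j) j

/-- The matrix `W_L ⋯ W_1` that the network represents. -/
def network (θ : Params n) : Matrix (Fin (n (Fin.last L))) (Fin (n 0)) ℝ :=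
  below θ (Fin.last L)

/-- The training cost `(1 / 2N) ∑ᵢ ‖R xᵢ - W_L ⋯ W_1 xᵢ‖²`. -/
def loss {N : ℕ} (R : Matrix (Fin (n (Fin.last L))) (Fin (n 0)) ℝ)
    (x : Fin N → EuclideanSpace ℝ (Fin (n 0))) (θ : Params n) : ℝ :=
  1 / (2 * (N : ℝ)) *
    ∑ i, ‖Matrix.toEuclideanLin R (x i) - Matrix.toEuclideanLin (network θ) (x i)‖ ^ 2

/-- The `k`-th iterate of gradient descent on `f` with step size `δ`, started at `θ₀`. -/
def gradientDescent {E : Type*} [NormedAddCommGroup E] [InnerProductSpace ℝ E] [CompleteSpace E]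
    (f : E → ℝ) (δ : ℝ) (θ₀ : E) (k : ℕ) : E :=
  (fun θ => θ - δ • gradient f θ)^[k] θ₀

/-- `u` and `v` are (unit) left and right singular vectors of `A` that belong together and
correspond to the largest singular value of `A`. -/
def IsTopSingularPair {a b : ℕ} (A : Matrix (Fin a) (Fin b) ℝ)
    (u : EuclideanSpace ℝ (Fin a)) (v : EuclideanSpace ℝ (Fin b)) : Prop :=
  ‖u‖ = 1 ∧ ‖v‖ = 1 ∧
    Matrix.toEuclideanLin A v = (Matrix.toEuclideanLin A).singularValues 0 • u ∧
    Matrix.toEuclideanLin A.transpose u = (Matrix.toEuclideanLin A).singularValues 0 • v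

/-- `pNorm θ v j = ‖W_j ⋯ W_1 v‖`, so that `pNorm θ v 0 = ‖v‖`. -/
def pNorm (θ : Params n) (v : EuclideanSpace ℝ (Fin (n 0))) (j : Fin (L + 1)) : ℝ :=
  ‖Matrix.toEuclideanLin (below θ j) v‖

/-- `qNorm θ u j = ‖uᵀ W_L ⋯ W_{j+1}‖`, so that `qNorm θ u L = ‖u‖`. The index is that of the
width reached: this is the number usually written `q_{j+1}`. -/
def qNorm (θ : Params n) (u : EuclideanSpace ℝ (Fin (n (Fin.last L)))) (j : Fin (L + 1)) : ℝ :=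
  ‖Matrix.toEuclideanLin (above θ j).transpose u‖

/-- `∑_{j=1}^{L} p_{j-1}² q_{j+1}²`, where `p_{j-1} = ‖W_{j-1} ⋯ W_1 v‖` and
`q_{j+1} = ‖uᵀ W_L ⋯ W_{j+1}‖`. -/
def sharpnessSum (θ : Params n) (u : EuclideanSpace ℝ (Fin (n (Fin.last L))))
    (v : EuclideanSpace ℝ (Fin (n 0))) : ℝ :=
  ∑ j : Fin L, pNorm θ v j.castSucc ^ 2 * qNorm θ u j.succ ^ 2

end

end DeepLinear

namespace DeepLinear

open scoped ContDiff RealInnerProductSpace Matrix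

/-! ### Null sets for analytic iterations: orbits rarely converge to expanding points -/

section Dynamics

/-! Write `G = id - δ ∇f`; its derivative is the symmetric map `I - δH`, with `H` the Hessian of
`f`. Almost no orbit of `G` converges to a point where this derivative expands a vector
(`ae_not_tendsto_expanding`). No stable manifold is needed: near such a point a quadratic form,
positive on the expanded vector, grows geometrically along differences of orbits (`exists_cone`), so
the trapped set has infinitely many disjoint small translates and is null. Null sets pull back to
null sets because the Jacobian of `G` is analytic and nonzero somewhere (`exists_nondegenerate`). So
almost surely a limit is critical with `0 ≤ H` and `δ ⟪HΔ, Δ⟫ ≤ 2 ‖Δ‖²`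
(`ae_limit_gradientDescent`).

Let `S` be the sum in the bound and `T` the gradient of `θ ↦ uᵀ W_L ⋯ W_1 v`, which is `steepDir`.
Then `‖T‖² = S`, and `⟪HT, T⟫ ≥ S²` would give `δ S² ≤ 2 S`. With whitened data, `⟪HT, T⟫` is the
squared norm of the first variation of the network plus twice the pairing of the residual `E` with
its second-order coefficient. The second term has no evident sign, and positivity of `H` controls
it. If `σ > 0`, criticality makes `E` annihilate `u` and `v`, so one can cancel the `uvᵀ` component
of the first variation without changing the second term (`sq_le_hessForm_of_pos`). If `σ = 0`, the
Hessian is affine along suitable lines, and the vanishing of the slopes makes the second term zero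
for `T` (`sq_le_hessForm_of_network_eq_zero`). -/

theorem ae_ne_zero_of_analytic_real {g : ℝ → ℝ} (hg : ContDiff ℝ ω g) {a : ℝ} (ha : g a ≠ 0) :
    ∀ᵐ t : ℝ, g t ≠ 0 := by
  have h1 : AnalyticOnNhd ℝ g Set.univ := contDiff_omega_iff_analyticOnNhd.1 hg
  have h2 := h1.preimage_zero_mem_codiscrete ha
  have h3 := ae_restrict_le_codiscreteWithin (μ := (volume : Measure ℝ)) MeasurableSet.univ h2
  rw [Measure.restrict_univ] at h3
  exact h3

variable {E : Type*} [NormedAddCommGroup E] [InnerProductSpace ℝ E] [FiniteDimensional ℝ E]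

theorem contDiff_det_fderiv {G : E → E} (hG : ContDiff ℝ ω G) :
    ContDiff ℝ ω (fun x => (fderiv ℝ G x).det) := by
  let b := Module.finBasis ℝ E
  have h1 : ∀ x, (fderiv ℝ G x).det =
      (LinearMap.toMatrix b b (fderiv ℝ G x : E →ₗ[ℝ] E)).det := fun x =>
    (LinearMap.det_toMatrix b _).symm
  simp only [h1, Matrix.det_apply, LinearMap.toMatrix_apply]
  refine ContDiff.sum fun σ _ => ContDiff.const_smul _ (contDiff_prod fun i _ => ?_)
  have h2 : ContDiff ℝ ω (fderiv ℝ G) := hG.fderiv_right (by simp)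
  have h3 : ContDiff ℝ ω fun x => fderiv ℝ G x (b i) := h2.clm_apply contDiff_const
  exact (LinearMap.toContinuousLinearMap (b.coord (σ i))).contDiff.comp h3

/-- If `A` is symmetric and expands some vector, some quadratic form `‖A d‖² - c ‖d‖²` is positive
there and grows strictly along `A`. -/
theorem exists_cone {A : E →L[ℝ] E} (hA : ∀ x y, ⟪A x, y⟫ = ⟪x, A y⟫) {e : E} (he : ‖e‖ < ‖A e‖) :
    ∃ c > 1, ∃ ε > 0, 0 < ‖A e‖ ^ 2 - c * ‖e‖ ^ 2 ∧ ∀ d r, ‖r‖ ≤ ε * ‖d‖ →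
      c * (‖A d‖ ^ 2 - c * ‖d‖ ^ 2) ≤ ‖A (A d + r)‖ ^ 2 - c * ‖A d + r‖ ^ 2 := by
  have hne : 0 < ‖e‖ := by
    rw [norm_pos_iff]; rintro rfl; simp at he
  let T : E →ₗ[ℝ] E := (A : E →ₗ[ℝ] E) ∘ₗ (A : E →ₗ[ℝ] E)
  have hfin : {c : ℝ | Module.End.HasEigenvalue T c}.Finite := Module.End.finite_hasEigenvalue T
  have hlt : (1 : ℝ) < ‖A e‖ ^ 2 / ‖e‖ ^ 2 := by
    rw [one_lt_div (by positivity)]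
    exact pow_lt_pow_left₀ he hne.le two_ne_zero
  -- Avoiding the eigenvalues of `A²` makes `A² - c` injective, hence bounded below in finite
  -- dimension.
  obtain ⟨c, hc, hcT⟩ := ((Set.Ioo_infinite hlt).sdiff hfin).nonempty
  have hc1 : 1 < c := hc.1
  have hce : c * ‖e‖ ^ 2 < ‖A e‖ ^ 2 := (lt_div_iff₀ (by positivity)).1 hc.2
  let B : E →ₗ[ℝ] E := T - c • LinearMap.id
  have hker : LinearMap.ker B = ⊥ := by
    by_contra h
    apply hcT
    rw [Set.mem_ofPred_eq, Module.End.hasEigenvalue_iff, Module.End.eigenspace_def]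
    exact h
  obtain ⟨K, hK0, hK⟩ := B.exists_antilipschitzWith hker
  have hB : ∀ d, ‖d‖ ≤ K * ‖A (A d) - c • d‖ := fun d => by
    simpa [B, T] using hK.le_mul_dist d 0
  have hK0' : (0 : ℝ) < K := hK0
  set M := ‖A‖
  have hM : 0 ≤ M := norm_nonneg _
  -- `N` collects the losses from `2⟪A²d, Ar⟫`, `2c⟪Ad, r⟫` and `c‖r‖²`, each measured in units of
  -- `ε ‖d‖²`.
  set N := 2 * M ^ 3 + 2 * c * M + c with hN
  have hNpos : 0 < N := by positivity
  refine ⟨c, hc1, min 1 (1 / (K ^ 2 * N)), by positivity, by linarith, fun d r hr => ?_⟩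
  set ε := min 1 (1 / ((K : ℝ) ^ 2 * N))
  have hε0 : 0 < ε := by positivity
  have hε1 : ε ≤ 1 := min_le_left _ _
  have hε2 : ε * N * K ^ 2 ≤ 1 := by
    have : ε ≤ 1 / ((K : ℝ) ^ 2 * N) := min_le_right _ _
    rw [le_div_iff₀ (by positivity)] at this
    linarith
  have hr1 : ‖r‖ ≤ ‖d‖ := hr.trans (by nlinarith [norm_nonneg d])
  have e1 : ‖A (A d + r)‖ ^ 2 = ‖A (A d)‖ ^ 2 + 2 * ⟪A (A d), A r⟫ + ‖A r‖ ^ 2 := by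
    rw [map_add, norm_add_sq_real]
  have e2 : ‖A d + r‖ ^ 2 = ‖A d‖ ^ 2 + 2 * ⟪A d, r⟫ + ‖r‖ ^ 2 := norm_add_sq_real _ _
  -- By symmetry `⟪A²d, d⟫ = ‖Ad‖²`, so for `r = 0` the gain of the form over `c` times itself is
  -- exactly this square.
  have e3 : ‖A (A d) - c • d‖ ^ 2 = ‖A (A d)‖ ^ 2 - 2 * (c * ‖A d‖ ^ 2) + c ^ 2 * ‖d‖ ^ 2 := by
    rw [norm_sub_sq_real, real_inner_smul_right, hA, real_inner_self_eq_norm_sq, norm_smul,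
      mul_pow, Real.norm_eq_abs, sq_abs]
  have hAd : ‖A d‖ ≤ M * ‖d‖ := A.le_opNorm d
  have hAAd : ‖A (A d)‖ ≤ M * (M * ‖d‖) :=
    (A.le_opNorm _).trans (mul_le_mul_of_nonneg_left hAd hM)
  have hAr : ‖A r‖ ≤ M * ‖r‖ := A.le_opNorm r
  have i1 : -(M ^ 3 * (ε * ‖d‖ ^ 2)) ≤ ⟪A (A d), A r⟫ := by
    have h := abs_real_inner_le_norm (A (A d)) (A r)
    have h' : ‖A (A d)‖ * ‖A r‖ ≤ (M * (M * ‖d‖)) * (M * (ε * ‖d‖)) :=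
      mul_le_mul hAAd (hAr.trans (mul_le_mul_of_nonneg_left hr hM)) (norm_nonneg _) (by positivity)
    have := neg_abs_le ⟪A (A d), A r⟫
    linarith
  have i2 : ⟪A d, r⟫ ≤ M * (ε * ‖d‖ ^ 2) := by
    have h := real_inner_le_norm (A d) r
    have h' : ‖A d‖ * ‖r‖ ≤ (M * ‖d‖) * (ε * ‖d‖) :=
      mul_le_mul hAd hr (norm_nonneg _) (by positivity)
    linarith
  have i3 : ‖r‖ ^ 2 ≤ ε * ‖d‖ ^ 2 := by
    have : ‖r‖ * ‖r‖ ≤ (ε * ‖d‖) * ‖d‖ := mul_le_mul hr hr1 (norm_nonneg _) (by positivity)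
    linarith
  have i4 : ε * N * ‖d‖ ^ 2 ≤ ‖A (A d) - c • d‖ ^ 2 := by
    have h : ‖d‖ ^ 2 ≤ (K * ‖A (A d) - c • d‖) ^ 2 :=
      pow_le_pow_left₀ (norm_nonneg _) (hB d) 2
    have h2 : ε * N * ‖d‖ ^ 2 ≤ ε * N * (K * ‖A (A d) - c • d‖) ^ 2 :=
      mul_le_mul_of_nonneg_left h (by positivity)
    have h3 := mul_le_mul_of_nonneg_right hε2 (sq_nonneg ‖A (A d) - c • d‖)
    nlinarith
  have i2' := mul_le_mul_of_nonneg_left i2 (by linarith : 0 ≤ 2 * c)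
  have i3' := mul_le_mul_of_nonneg_left i3 (by linarith : 0 ≤ c)
  rw [e1, e2]
  rw [e3, hN] at i4
  nlinarith [sq_nonneg ‖A r‖]

variable [MeasurableSpace E] [BorelSpace E]

/-- The zero set of an analytic function that is not identically zero is a null set. -/
theorem ae_ne_zero_of_analytic (μ : Measure E) [μ.IsAddHaarMeasure] {D : E → ℝ}
    (hD : ContDiff ℝ ω D) {a : E} (ha : D a ≠ 0) : ∀ᵐ x ∂μ, D x ≠ 0 := by
  -- On every line through `a` the zeros are null; Fubini then yields one nonzero scale `r` that is
  -- good for almost every direction, and scaling and translation finish.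
  have hray : ∀ y : E, ∀ᵐ r : ℝ, D (a + r • y) ≠ 0 := fun y =>
    ae_ne_zero_of_analytic_real (g := fun r => D (a + r • y))
      (hD.comp (contDiff_const.add (contDiff_id.smul contDiff_const))) (a := 0) (by simpa using ha)
  have hmeas : MeasurableSet {z : E × ℝ | D (a + z.2 • z.1) ≠ 0} := by
    have : IsOpen {z : E × ℝ | D (a + z.2 • z.1) ≠ 0} :=
      isOpen_ne_fun (hD.continuous.comp (by fun_prop)) continuous_const
    exact this.measurableSet
  have h1 : ∀ᵐ r : ℝ, ∀ᵐ y ∂μ, D (a + r • y) ≠ 0 :=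
    (Measure.ae_ae_comm (μ := μ) (ν := (volume : Measure ℝ))
      (p := fun y r => D (a + r • y) ≠ 0) hmeas).1 (Eventually.of_forall hray)
  have h2 : ∀ᵐ r : ℝ, r ≠ 0 := by
    simp [ae_iff]
  obtain ⟨r, hr, hr0⟩ := (h1.and h2).exists
  have h3 : μ ((r • ·) ⁻¹' {y | D (a + y) = 0}) = 0 := by
    simpa [ae_iff] using hr
  rw [Measure.addHaar_preimage_smul μ hr0, mul_eq_zero] at h3
  have h4 : μ {y | D (a + y) = 0} = 0 := by
    rcases h3 with h3 | h3
    · rw [ENNReal.ofReal_eq_zero] at h3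
      have : 0 < |(r ^ Module.finrank ℝ E)⁻¹| := by positivity
      linarith
    · exact h3
  have h5 : μ ((fun y => a + y) ⁻¹' {x | D x = 0}) = 0 := h4
  rw [measure_preimage_add] at h5
  simpa [ae_iff] using h5

/-- Preimages of null sets under an analytic map are null if the Jacobian does not vanish
identically. -/
theorem preimage_null_of_analytic (μ : Measure E) [μ.IsAddHaarMeasure] {G : E → E}
    (hG : ContDiff ℝ ω G) {a : E} (ha : (fderiv ℝ G a).det ≠ 0) {s : Set E} (hs : μ s = 0) :
    μ (G ⁻¹' s) = 0 := by
  have h1 := ae_ne_zero_of_analytic μ (contDiff_det_fderiv hG) ha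
  -- Where the Jacobian is nonzero, the preimage is locally the image of `s` under a differentiable
  -- local inverse.
  have h2 : μ (G ⁻¹' s ∩ {x | (fderiv ℝ G x).det ≠ 0}) = 0 := by
    refine measure_null_of_locally_null _ fun x hx => ?_
    have hx2 : (fderiv ℝ G x).det ≠ 0 := hx.2
    let e := (fderiv ℝ G x).toContinuousLinearEquivOfDetNeZero hx2
    have hde : HasFDerivAt G (e : E →L[ℝ] E) x := by
      have := (hG.differentiable (by simp)).differentiableAt (x := x) |>.hasFDerivAt
      convert! this using 1
    have hGx : ContDiffAt ℝ ω G x := hG.contDiffAt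
    let φ := hGx.toOpenPartialHomeomorph G hde (by simp)
    have hsymm : ContDiffAt ℝ ω φ.symm (G x) := by
      refine φ.contDiffAt_symm (f₀' := e) (hGx.image_mem_toOpenPartialHomeomorph_target hde _) ?_ ?_
      · have : φ.symm (G x) = x := φ.left_inv (hGx.mem_toOpenPartialHomeomorph_source hde _)
        rw [this]; exact hde
      · have : φ.symm (G x) = x := φ.left_inv (hGx.mem_toOpenPartialHomeomorph_source hde _)
        rw [this]; exact hGx
    have hev : ∀ᶠ y in 𝓝 (G x), ContDiffAt ℝ ω φ.symm y :=
      hsymm.eventually (by simp)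
    have hev2 : ∀ᶠ z in 𝓝 x, ContDiffAt ℝ ω φ.symm (G z) :=
      hG.continuous.continuousAt.eventually hev
    have hev3 : ∀ᶠ z in 𝓝 x, z ∈ φ.source :=
      φ.open_source.mem_nhds (hGx.mem_toOpenPartialHomeomorph_source hde _)
    refine ⟨G ⁻¹' s ∩ {z | ContDiffAt ℝ ω φ.symm (G z) ∧ z ∈ φ.source}, ?_, ?_⟩
    · refine inter_mem (mem_of_superset self_mem_nhdsWithin fun z hz => hz.1) ?_
      exact mem_nhdsWithin_of_mem_nhds (hev2.and hev3)
    · have h3 : μ (φ.symm '' (s ∩ {y | ContDiffAt ℝ ω φ.symm y})) = 0 := by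
        refine addHaar_image_eq_zero_of_differentiableOn_of_addHaar_eq_zero μ (fun y hy => ?_)
          (measure_mono_null Set.inter_subset_left hs)
        have hy2 : ContDiffAt ℝ ω φ.symm y := hy.2
        exact (hy2.differentiableAt (by simp)).differentiableWithinAt
      refine measure_mono_null ?_ h3
      rintro z ⟨hz1, hz2, hz3⟩
      exact ⟨G z, ⟨hz1, hz2⟩, φ.left_inv hz3⟩
  refine measure_mono_null (t := (G ⁻¹' s ∩ {x | (fderiv ℝ G x).det ≠ 0}) ∪
    {x | ¬ (fderiv ℝ G x).det ≠ 0}) ?_ (measure_union_null h2 h1)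
  intro x hx
  by_cases h : (fderiv ℝ G x).det ≠ 0
  · exact Or.inl ⟨hx, h⟩
  · exact Or.inr h

/-- Near a point where the derivative of `G` is symmetric and expands some vector, only a null set
of points has its whole forward orbit. -/
theorem exists_nhds_trapped_null (μ : Measure E) [μ.IsAddHaarMeasure] {G : E → E} {p : E}
    {A : E →L[ℝ] E} (hG : HasStrictFDerivAt G A p) (hGc : Continuous G)
    (hA : ∀ x y, ⟪A x, y⟫ = ⟪x, A y⟫) {e : E} (he : ‖e‖ < ‖A e‖) :
    ∃ U ∈ 𝓝 p, μ {x | ∀ k, G^[k] x ∈ U} = 0 := by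
  obtain ⟨c, hc, ε, hε, hQe, hcone⟩ := exists_cone hA he
  have h1 : ∀ᶠ z in 𝓝 (p, p), ‖G z.1 - G z.2 - A (z.1 - z.2)‖ ≤ ε * ‖z.1 - z.2‖ := by
    exact hG.isLittleO.def hε
  rw [nhds_prod_eq] at h1
  obtain ⟨V, hV, hVsub⟩ := mem_prod_self_iff.1 h1
  have hVG : ∀ x ∈ V, ∀ y ∈ V, ‖G x - G y - A (x - y)‖ ≤ ε * ‖x - y‖ :=
    fun x hx y hy => hVsub (Set.mk_mem_prod hx hy)
  obtain ⟨ρ, hρ, hρV⟩ := Metric.nhds_basis_closedBall.mem_iff.1 hV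
  refine ⟨Metric.closedBall p ρ, Metric.closedBall_mem_nhds p hρ, ?_⟩
  set s : Set E := {x | ∀ k, G^[k] x ∈ Metric.closedBall p ρ} with hs
  have hsm : MeasurableSet s := by
    have : IsClosed s := by
      rw [hs, Set.ofPred_forall]
      exact isClosed_iInter fun k => Metric.isClosed_closedBall.preimage (hGc.iterate k)
    exact this.measurableSet
  set Q : E → ℝ := fun d => ‖A d‖ ^ 2 - c * ‖d‖ ^ 2 with hQ
  have hgrow : ∀ x ∈ s, ∀ y ∈ s, ∀ k, c ^ k * Q (x - y) ≤ Q (G^[k] x - G^[k] y) := by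
    intro x hx y hy k
    induction k with
    | zero => simp
    | succ k ih =>
      have hb := hVG _ (hρV (hx k)) _ (hρV (hy k))
      have hc' := hcone _ _ hb
      rw [Function.iterate_succ_apply', Function.iterate_succ_apply']
      have : A (G^[k] x - G^[k] y) + (G (G^[k] x) - G (G^[k] y) - A (G^[k] x - G^[k] y)) =
        G (G^[k] x) - G (G^[k] y) := by abel
      simp only [this] at hc'
      calc c ^ (k + 1) * Q (x - y) = c * (c ^ k * Q (x - y)) := by ring
        _ ≤ c * Q (G^[k] x - G^[k] y) := mul_le_mul_of_nonneg_left ih (by linarith)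
        _ ≤ _ := hc'
  -- Differences of trapped orbits stay bounded, while a positive value of `Q` would grow like `c ^
  -- k`.
  have hnonpos : ∀ x ∈ s, ∀ y ∈ s, Q (x - y) ≤ 0 := by
    intro x hx y hy
    by_contra! hpos
    have hbd : ∀ k, c ^ k * Q (x - y) ≤ (‖A‖ * (ρ + ρ)) ^ 2 := by
      intro k
      refine (hgrow x hx y hy k).trans ?_
      have hd : ‖G^[k] x - G^[k] y‖ ≤ ρ + ρ := by
        rw [← dist_eq_norm]
        exact (dist_triangle_right _ _ p).trans (add_le_add (hx k) (hy k))
      have hAd : ‖A (G^[k] x - G^[k] y)‖ ≤ ‖A‖ * (ρ + ρ) :=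
        (A.le_opNorm _).trans (mul_le_mul_of_nonneg_left hd (norm_nonneg _))
      have := pow_le_pow_left₀ (norm_nonneg _) hAd 2
      have : 0 ≤ c * ‖G^[k] x - G^[k] y‖ ^ 2 := by positivity
      simp only [hQ]; linarith
    obtain ⟨k, hk⟩ := pow_unbounded_of_one_lt ((‖A‖ * (ρ + ρ)) ^ 2 / Q (x - y)) hc
    rw [div_lt_iff₀ hpos] at hk
    exact absurd (hbd k) (not_le.2 hk)
  -- If two translates along `e` met, two points of `s` would differ by a nonzero multiple of `e`,
  -- where `Q` is positive.
  refine Measure.addHaar_eq_zero_of_disjoint_translates μ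
    (u := fun m : ℕ => (1 / ((m : ℝ) + 1)) • e) ?_ ?_ hsm
  · refine isBounded_iff_forall_norm_le.2 ⟨‖e‖, ?_⟩
    rintro _ ⟨m, rfl⟩
    rw [norm_smul, Real.norm_of_nonneg (by positivity)]
    have : 1 / ((m : ℝ) + 1) ≤ 1 := by
      rw [div_le_one (by positivity)]; linarith [Nat.cast_nonneg (α := ℝ) m]
    exact mul_le_of_le_one_left (norm_nonneg _) this
  · intro m k hmk
    simp only [Function.onFun, Set.singleton_add, Set.disjoint_left]
    rintro _ ⟨x, hx, rfl⟩ ⟨y, hy, hxy⟩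
    have hd : y - x = (1 / ((m : ℝ) + 1) - 1 / ((k : ℝ) + 1)) • e := by
      rw [sub_smul, sub_eq_sub_iff_add_eq_add, add_comm y]; simpa [add_comm] using hxy
    have h0 : (1 / ((m : ℝ) + 1) - 1 / ((k : ℝ) + 1)) ≠ 0 := by
      intro h
      have := sub_eq_zero.1 h
      rw [div_eq_div_iff (by positivity) (by positivity)] at this
      apply hmk
      have h' : (k : ℝ) = m := by linarith
      exact_mod_cast h'.symm
    have h1 := hnonpos y hy x hx
    simp only [hQ, hd, map_smul, norm_smul, mul_pow, Real.norm_eq_abs, sq_abs] at h1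
    have : 0 < (1 / ((m : ℝ) + 1) - 1 / ((k : ℝ) + 1)) ^ 2 := by positivity
    nlinarith

/-- Almost no orbit converges to a point where the derivative of `G` expands some vector. -/
theorem ae_not_tendsto_expanding (μ : Measure E) [μ.IsAddHaarMeasure] {G : E → E}
    (hG : ContDiff ℝ ω G) {a : E} (ha : (fderiv ℝ G a).det ≠ 0)
    (hsymm : ∀ p x y, ⟪fderiv ℝ G p x, y⟫ = ⟪x, fderiv ℝ G p y⟫) :
    ∀ᵐ x ∂μ, ∀ p, Tendsto (fun k => G^[k] x) atTop (𝓝 p) → ∀ e, ‖fderiv ℝ G p e‖ ≤ ‖e‖ := by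
  set bad : Set E := {p | ∃ e, ‖e‖ < ‖fderiv ℝ G p e‖}
  have hU : ∀ p, ∃ U ∈ 𝓝 p, p ∈ bad → μ {x | ∀ k, G^[k] x ∈ U} = 0 := by
    intro p
    by_cases hp : p ∈ bad
    · obtain ⟨e, he⟩ := hp
      obtain ⟨U, hU, h0⟩ := exists_nhds_trapped_null μ
        (hG.contDiffAt.hasStrictFDerivAt (by simp)) hG.continuous (hsymm p) he
      exact ⟨U, hU, fun _ => h0⟩
    · exact ⟨Set.univ, univ_mem, fun h => absurd h hp⟩
  choose U hUn hU0 using hU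
  -- The expanding points may be uncountable; by Lindelöf, countably many of the neighbourhoods
  -- cover them.
  obtain ⟨t, htb, htc, htU⟩ := TopologicalSpace.countable_cover_nhdsWithin
    (s := bad) (f := fun p => interior (U p))
    (fun p _ => mem_nhdsWithin_of_mem_nhds (interior_mem_nhds.2 (hUn p)))
  have hpre : ∀ m : ℕ, ∀ s : Set E, μ s = 0 → μ (G^[m] ⁻¹' s) = 0 := by
    intro m
    induction m with
    | zero => intro s hs; simpa using hs
    | succ m ih =>
      intro s hs
      rw [Function.iterate_succ', Set.preimage_comp]
      exact ih _ (preimage_null_of_analytic μ hG ha hs)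
  have hnull : μ (⋃ p ∈ t, ⋃ m : ℕ, G^[m] ⁻¹' {x | ∀ k, G^[k] x ∈ U p}) = 0 := by
    rw [measure_biUnion_null_iff htc]
    exact fun p hp => measure_iUnion_null fun m => hpre m _ (hU0 p (htb hp))
  have hae : ∀ᵐ x ∂μ, x ∉ ⋃ p ∈ t, ⋃ m : ℕ, G^[m] ⁻¹' {x | ∀ k, G^[k] x ∈ U p} :=
    measure_eq_zero_iff_ae_notMem.1 hnull
  filter_upwards [hae] with x hx p hp e
  by_contra! he
  have hpb : p ∈ bad := ⟨e, he⟩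
  obtain ⟨q, hq, hpq⟩ := Set.mem_iUnion₂.1 (htU hpb)
  obtain ⟨m, hm⟩ := eventually_atTop.1 (hp.eventually (isOpen_interior.mem_nhds hpq))
  apply hx
  refine Set.mem_iUnion₂.2 ⟨q, hq, Set.mem_iUnion.2 ⟨m, fun k => ?_⟩⟩
  rw [← Function.iterate_add_apply]
  exact interior_subset (hm _ (Nat.le_add_left m k))

end Dynamics

/-! ### Gradient descent: first and second order conditions at a limit -/

section GradientDescent

variable {E : Type*} [NormedAddCommGroup E] [InnerProductSpace ℝ E] [FiniteDimensional ℝ E]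

/-- The inverse Riesz isomorphism as a real-linear map. -/
noncomputable def rieszSymm (E : Type*) [NormedAddCommGroup E] [InnerProductSpace ℝ E]
    [FiniteDimensional ℝ E] : (E →L[ℝ] ℝ) →L[ℝ] E :=
  LinearMap.toContinuousLinearMap
    { toFun := fun l => (InnerProductSpace.toDual ℝ E).symm l
      map_add' := fun a b => map_add _ a b
      map_smul' := fun c a => by simp }

theorem gradient_eq_rieszSymm (f : E → ℝ) :
    gradient f = fun x => rieszSymm E (fderiv ℝ f x) := rfl

theorem inner_rieszSymm (l : E →L[ℝ] ℝ) (y : E) : ⟪rieszSymm E l, y⟫ = l y :=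
  InnerProductSpace.toDual_symm_apply

theorem contDiff_gradient {f : E → ℝ} (hf : ContDiff ℝ ω f) : ContDiff ℝ ω (gradient f) := by
  rw [gradient_eq_rieszSymm]
  exact (rieszSymm E).contDiff.comp (hf.fderiv_right (by simp))

theorem inner_fderiv_gradient {f : E → ℝ} (hf : ContDiff ℝ ω f) (p x y : E) :
    ⟪fderiv ℝ (gradient f) p x, y⟫ = fderiv ℝ (fderiv ℝ f) p x y := by
  have hd : DifferentiableAt ℝ (fderiv ℝ f) p :=
    (ContDiff.differentiable (n := ω) (hf.fderiv_right (by simp)) (by simp)).differentiableAt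
  have h : HasFDerivAt (gradient f) ((rieszSymm E).comp (fderiv ℝ (fderiv ℝ f) p)) p := by
    rw [gradient_eq_rieszSymm]
    exact (rieszSymm E).hasFDerivAt.comp p hd.hasFDerivAt
  rw [h.fderiv]
  exact inner_rieszSymm _ _

theorem inner_fderiv_gradient_symm {f : E → ℝ} (hf : ContDiff ℝ ω f) (p x y : E) :
    ⟪fderiv ℝ (gradient f) p x, y⟫ = ⟪x, fderiv ℝ (gradient f) p y⟫ := by
  rw [inner_fderiv_gradient hf, real_inner_comm, inner_fderiv_gradient hf]
  exact (hf.contDiffAt.isSymmSndFDerivAt (by simp)) x y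

/-- Reduces the gradient and Hessian form to one-variable derivatives, which for a product of
matrices come from the product rule. -/
theorem variations_along_line {f : E → ℝ} (hf : ContDiff ℝ ω f) (θ Δ : E) {g : ℝ → ℝ} {g' : ℝ}
    (h1 : ∀ t, HasDerivAt (fun t => f (θ + t • Δ)) (g t) t) (h2 : HasDerivAt g g' 0) :
    ⟪gradient f θ, Δ⟫ = g 0 ∧ ⟪fderiv ℝ (gradient f) θ Δ, Δ⟫ = g' := by
  have hline : ∀ t : ℝ, HasDerivAt (fun t : ℝ => θ + t • Δ) Δ t := fun t => by
    simpa using ((hasDerivAt_id t).smul_const Δ).const_add θ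
  have hg : ∀ t, g t = fderiv ℝ f (θ + t • Δ) Δ := fun t => by
    have hfd : HasFDerivAt f (fderiv ℝ f (θ + t • Δ)) (θ + t • Δ) :=
      (hf.differentiable (by simp)).differentiableAt.hasFDerivAt
    exact (h1 t).unique (hfd.comp_hasDerivAt t (hline t))
  refine ⟨?_, ?_⟩
  · rw [hg 0, gradient_eq_rieszSymm, inner_rieszSymm]; simp
  · rw [inner_fderiv_gradient hf]
    have hd : HasFDerivAt (fderiv ℝ f) (fderiv ℝ (fderiv ℝ f) θ) (θ + (0 : ℝ) • Δ) := by
      rw [zero_smul, add_zero]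
      exact (ContDiff.differentiable (n := ω)
        (hf.fderiv_right (by simp)) (by simp)).differentiableAt.hasFDerivAt
    have h3 : HasDerivAt (fun t : ℝ => fderiv ℝ f (θ + t • Δ)) (fderiv ℝ (fderiv ℝ f) θ Δ) 0 :=
      hd.comp_hasDerivAt 0 (hline 0)
    have h4 := h3.clm_apply (hasDerivAt_const (0 : ℝ) Δ)
    have h5 : g = fun t : ℝ => fderiv ℝ f (θ + t • Δ) Δ := funext hg
    rw [h5] at h2
    simpa using h4.unique h2

variable [MeasurableSpace E] [BorelSpace E]

/-- Almost all limits of gradient descent are critical points where the Hessian has its spectrum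
in `[0, 2 / δ]`. -/
theorem ae_limit_gradientDescent (μ : Measure E) [μ.IsAddHaarMeasure] {f : E → ℝ}
    (hf : ContDiff ℝ ω f) {δ : ℝ} (hδ : 0 < δ) {a : E}
    (ha : ∀ Δ, Δ = δ • fderiv ℝ (gradient f) a Δ → Δ = 0) :
    ∀ᵐ θ₀ ∂μ, ∀ θ, Tendsto (gradientDescent f δ θ₀) atTop (𝓝 θ) →
      gradient f θ = 0 ∧ ∀ Δ, 0 ≤ ⟪fderiv ℝ (gradient f) θ Δ, Δ⟫ ∧
        δ * ⟪fderiv ℝ (gradient f) θ Δ, Δ⟫ ≤ 2 * ‖Δ‖ ^ 2 := by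
  set G : E → E := fun θ => θ - δ • gradient f θ with hGdef
  have hgrad := contDiff_gradient hf
  have hG : ContDiff ℝ ω G := contDiff_id.sub (contDiff_const.smul hgrad)
  have hfd : ∀ p Δ, fderiv ℝ G p Δ = Δ - δ • fderiv ℝ (gradient f) p Δ := by
    intro p Δ
    have h1 : HasFDerivAt (gradient f) (fderiv ℝ (gradient f) p) p :=
      (hgrad.differentiable (by simp)).differentiableAt.hasFDerivAt
    have h2 : HasFDerivAt G (ContinuousLinearMap.id ℝ E - δ • fderiv ℝ (gradient f) p) p :=
      (hasFDerivAt_id p).sub (h1.const_smul δ)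
    rw [h2.fderiv]; rfl
  have hdet : (fderiv ℝ G a).det ≠ 0 := by
    intro h0
    have h1 : LinearMap.det (fderiv ℝ G a : E →ₗ[ℝ] E) = 0 := h0
    obtain ⟨v, hv, hv0⟩ := (Submodule.ne_bot_iff _).1 (LinearMap.bot_lt_ker_of_det_eq_zero h1).ne'
    apply hv0
    apply ha
    have : fderiv ℝ G a v = 0 := hv
    rw [hfd, sub_eq_zero] at this
    exact this
  have hsymm : ∀ p x y, ⟪fderiv ℝ G p x, y⟫ = ⟪x, fderiv ℝ G p y⟫ := by
    intro p x y
    rw [hfd, hfd, inner_sub_left, inner_sub_right, real_inner_smul_left, real_inner_smul_right,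
      inner_fderiv_gradient_symm hf]
  filter_upwards [ae_not_tendsto_expanding μ hG hdet hsymm] with θ₀ hθ₀ θ hθ
  refine ⟨?_, fun Δ => ?_⟩
  · have h1 : Tendsto (fun k => G (G^[k] θ₀)) atTop (𝓝 (G θ)) :=
      (hG.continuous.tendsto θ).comp hθ
    have h2 : Tendsto (fun k => G^[k + 1] θ₀) atTop (𝓝 θ) := (tendsto_add_atTop_iff_nat 1).2 hθ
    simp only [Function.iterate_succ_apply'] at h2
    have h3 : G θ = θ := tendsto_nhds_unique h1 h2
    simp only [hGdef, sub_eq_self, smul_eq_zero] at h3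
    exact h3.resolve_left hδ.ne'
  · have h1 := hθ₀ θ hθ Δ
    rw [hfd] at h1
    set y := fderiv ℝ (gradient f) θ Δ
    have h2 := pow_le_pow_left₀ (norm_nonneg _) h1 2
    rw [norm_sub_sq_real, real_inner_smul_right, norm_smul, mul_pow, Real.norm_eq_abs, sq_abs,
      real_inner_comm] at h2
    -- This is `‖Δ - δy‖² ≤ ‖Δ‖²` divided by `δ`. It gives positivity at once, and the upper bound
    -- through Cauchy–Schwarz.
    have h3 : δ * ‖y‖ ^ 2 ≤ 2 * ⟪y, Δ⟫ := by
      have : δ * (δ * ‖y‖ ^ 2) ≤ δ * (2 * ⟪y, Δ⟫) := by linarith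
      exact le_of_mul_le_mul_left this hδ
    have h4 : 0 ≤ ⟪y, Δ⟫ := by nlinarith [sq_nonneg ‖y‖]
    refine ⟨h4, ?_⟩
    have h5 := pow_le_pow_left₀ h4 (real_inner_le_norm y Δ) 2
    rcases h4.eq_or_lt with h6 | h6
    · rw [← h6]; nlinarith [sq_nonneg ‖Δ‖]
    · have h7 := mul_le_mul_of_nonneg_right h3 (sq_nonneg ‖Δ‖)
      have h8 := mul_le_mul_of_nonneg_left h5 hδ.le
      have : ⟪y, Δ⟫ * (δ * ⟪y, Δ⟫) ≤ ⟪y, Δ⟫ * (2 * ‖Δ‖ ^ 2) := by nlinarith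
      exact le_of_mul_le_mul_left this h6

end GradientDescent

/-! ### Matrix product rule and the Frobenius inner product -/

theorem hasDerivAt_matrix_mul {l m k : Type*} [Fintype m] {A : ℝ → Matrix l m ℝ}
    {B : ℝ → Matrix m k ℝ} {A' : Matrix l m ℝ} {B' : Matrix m k ℝ} {t : ℝ} (hA : ∀ a b, HasDerivAt (fun t => A t a b) (A' a b) t)
    (hB : ∀ a b, HasDerivAt (fun t => B t a b) (B' a b) t) (a : l) (b : k) :
    HasDerivAt (fun t => (A t * B t) a b) ((A' * B t + A t * B') a b) t := by
  simp only [Matrix.mul_apply, Matrix.add_apply, ← Finset.sum_add_distrib]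
  exact HasDerivAt.fun_sum fun i _ => (hA a i).mul (hB i b)

section Frobenius

variable {l m k : Type*} [Fintype l] [Fintype m] [Fintype k]

/-- The Frobenius inner product of two matrices. -/
def frob (A B : Matrix l m ℝ) : ℝ := ∑ a, ∑ b, A a b * B a b

theorem frob_add_right (A B C : Matrix l m ℝ) : frob A (B + C) = frob A B + frob A C := by
  simp [frob, mul_add, Finset.sum_add_distrib]

theorem frob_smul_right (c : ℝ) (A B : Matrix l m ℝ) : frob A (c • B) = c * frob A B := by
  simp only [frob, Finset.mul_sum, Matrix.smul_apply, smul_eq_mul, mul_left_comm]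

theorem frob_comm (A B : Matrix l m ℝ) : frob A B = frob B A := by
  simp only [frob, mul_comm]

theorem frob_add_self (A B : Matrix l m ℝ) :
    frob (A + B) (A + B) = frob A A + 2 * frob A B + frob B B := by
  rw [frob_add_right, frob_comm _ A, frob_comm _ B, frob_add_right, frob_add_right, frob_comm B A]
  ring

theorem frob_zero_right (A : Matrix l m ℝ) : frob A 0 = 0 := by simp [frob]

theorem frob_sum_right {ι : Type*} (s : Finset ι) (A : Matrix l m ℝ) (B : ι → Matrix l m ℝ) :
    frob A (∑ i ∈ s, B i) = ∑ i ∈ s, frob A (B i) := by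
  classical
  induction s using Finset.induction_on with
  | empty => simp [frob_zero_right]
  | insert i s hi ih => rw [Finset.sum_insert hi, Finset.sum_insert hi, frob_add_right, ih]

theorem frob_self_nonneg (A : Matrix l m ℝ) : 0 ≤ frob A A :=
  Finset.sum_nonneg fun _ _ => Finset.sum_nonneg fun _ _ => mul_self_nonneg _

theorem eq_zero_of_frob_self_eq_zero {A : Matrix l m ℝ} (h : frob A A = 0) : A = 0 := by
  have h1 := (Finset.sum_eq_zero_iff_of_nonneg
    (fun a _ => Finset.sum_nonneg fun b _ => mul_self_nonneg (A a b))).1 h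
  ext a b
  have h2 := (Finset.sum_eq_zero_iff_of_nonneg
    (fun b _ => mul_self_nonneg (A a b))).1 (h1 a (Finset.mem_univ _)) b (Finset.mem_univ _)
  exact mul_self_eq_zero.1 h2

theorem frob_eq_trace (A B : Matrix l m ℝ) : frob A B = (A.transpose * B).trace := by
  simp only [frob, Matrix.trace, Matrix.diag, Matrix.mul_apply, Matrix.transpose_apply]
  exact Finset.sum_comm

theorem frob_mul_left (A : Matrix l m ℝ) (B : Matrix l k ℝ) (C : Matrix k m ℝ) :
    frob A (B * C) = frob (B.transpose * A) C := by
  simp [frob_eq_trace, Matrix.mul_assoc]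

theorem frob_mul_right (A : Matrix l m ℝ) (B : Matrix l k ℝ) (C : Matrix k m ℝ) :
    frob A (B * C) = frob (A * C.transpose) B := by
  rw [frob_eq_trace, frob_eq_trace, Matrix.transpose_mul, Matrix.transpose_transpose,
    Matrix.mul_assoc, ← Matrix.mul_assoc, Matrix.trace_mul_comm]

theorem frob_vecMulVec (A : Matrix l m ℝ) (u : l → ℝ) (v : m → ℝ) :
    frob A (Matrix.vecMulVec u v) = u ⬝ᵥ A.mulVec v := by
  simp only [frob, Matrix.vecMulVec_apply, dotProduct, Matrix.mulVec, Finset.mul_sum]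
  exact Finset.sum_congr rfl fun a _ => Finset.sum_congr rfl fun b _ => by ring

theorem frob_sq_le (A B : Matrix l m ℝ) : frob A B ^ 2 ≤ frob A A * frob B B := by
  have h := Finset.sum_mul_sq_le_sq_mul_sq (Finset.univ : Finset (l × m))
    (fun p => A p.1 p.2) (fun p => B p.1 p.2)
  simp only [Fintype.sum_prod_type, pow_two (A _ _), pow_two (B _ _)] at h
  exact h

theorem hasDerivAt_frob {A B : ℝ → Matrix l m ℝ} {A' B' : Matrix l m ℝ} {t : ℝ}
    (hA : ∀ a b, HasDerivAt (fun t => A t a b) (A' a b) t)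
    (hB : ∀ a b, HasDerivAt (fun t => B t a b) (B' a b) t) :
    HasDerivAt (fun t => frob (A t) (B t)) (frob A' (B t) + frob (A t) B')
      t := by
  simp only [frob, ← Finset.sum_add_distrib]
  exact HasDerivAt.fun_sum fun a _ => HasDerivAt.fun_sum fun b _ => (hA a b).mul (hB a b)

end Frobenius

/-! ### Variations of the network and of the loss -/

section Network

variable {L : ℕ} {n : Fin (L + 1) → ℕ}

theorem below_zero (θ : Params n) : below θ 0 = 1 := rfl

theorem below_succ (θ : Params n) (j : Fin L) :
    below θ j.succ = weight θ j * below θ j.castSucc := rfl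

theorem above_last (θ : Params n) : above θ (Fin.last L) = 1 := by
  simp [above]

theorem above_castSucc (θ : Params n) (j : Fin L) :
    above θ j.castSucc = above θ j.succ * weight θ j := by
  simp [above]

theorem above_mul_below (θ : Params n) (j : Fin (L + 1)) : above θ j * below θ j = network θ := by
  induction j using Fin.reverseInduction with
  | last => rw [above_last, Matrix.one_mul]; rfl
  | cast j ih => rw [above_castSucc, Matrix.mul_assoc, ← below_succ, ih]

theorem weight_add (θ Δ : Params n) (j : Fin L) : weight (θ + Δ) j = weight θ j + weight Δ j := rfl

theorem weight_smul (c : ℝ) (θ : Params n) (j : Fin L) : weight (c • θ) j = c • weight θ j := rfl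

/-- The parameter vector with prescribed weight matrices. -/
def ofWeights (D : (j : Fin L) → Matrix (Fin (n j.succ)) (Fin (n j.castSucc)) ℝ) : Params n :=
  WithLp.toLp 2 fun i => D i.1 i.2.1 i.2.2

theorem weight_ofWeights (D : (j : Fin L) → Matrix (Fin (n j.succ)) (Fin (n j.castSucc)) ℝ)
    (j : Fin L) : weight (ofWeights D) j = D j := rfl

theorem inner_eq_sum_frob (θ θ' : Params n) :
    ⟪θ, θ'⟫ = ∑ j, frob (weight θ j) (weight θ' j) := by
  rw [PiLp.inner_apply, Fintype.sum_sigma]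
  refine Finset.sum_congr rfl fun j _ => ?_
  rw [Fintype.sum_prod_type]
  exact Finset.sum_congr rfl fun a _ => Finset.sum_congr rfl fun b _ => mul_comm _ _

theorem norm_sq_eq_sum_frob (θ : Params n) : ‖θ‖ ^ 2 = ∑ j, frob (weight θ j) (weight θ j) := by
  rw [← real_inner_self_eq_norm_sq, inner_eq_sum_frob]

/-- The parameter vector whose only nonzero weight matrix is `X`, in layer `j`. -/
def layerDir (j : Fin L) (X : Matrix (Fin (n j.succ)) (Fin (n j.castSucc)) ℝ) : Params n :=
  ofWeights (Pi.single j X)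

theorem weight_layerDir_self (j : Fin L) (X : Matrix (Fin (n j.succ)) (Fin (n j.castSucc)) ℝ) :
    weight (layerDir j X) j = X := by
  simp [layerDir, weight_ofWeights]

theorem weight_layerDir_of_ne {i j : Fin L} (h : i ≠ j)
    (X : Matrix (Fin (n j.succ)) (Fin (n j.castSucc)) ℝ) : weight (layerDir j X) i = 0 := by
  simp [layerDir, weight_ofWeights, h]

/-- The coefficient of `t` in `below (θ + t • Δ) j`. -/
noncomputable def belowFst (θ Δ : Params n) (j : Fin (L + 1)) : Matrix (Fin (n j)) (Fin (n 0)) ℝ :=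
  Fin.induction (motive := fun j => Matrix (Fin (n j)) (Fin (n 0)) ℝ)
    0 (fun j P => weight θ j * P + weight Δ j * below θ j.castSucc) j

/-- The coefficient of `t ^ 2` in `below (θ + t • Δ) j`. -/
noncomputable def belowSnd (θ Δ : Params n) (j : Fin (L + 1)) : Matrix (Fin (n j)) (Fin (n 0)) ℝ :=
  Fin.induction (motive := fun j => Matrix (Fin (n j)) (Fin (n 0)) ℝ)
    0 (fun j P => weight θ j * P + weight Δ j * belowFst θ Δ j.castSucc) j

theorem belowFst_zero (θ Δ : Params n) : belowFst θ Δ 0 = 0 := rfl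

theorem belowFst_succ (θ Δ : Params n) (j : Fin L) : belowFst θ Δ j.succ =
    weight θ j * belowFst θ Δ j.castSucc + weight Δ j * below θ j.castSucc := rfl

theorem belowSnd_zero (θ Δ : Params n) : belowSnd θ Δ 0 = 0 := rfl

theorem belowSnd_succ (θ Δ : Params n) (j : Fin L) : belowSnd θ Δ j.succ =
    weight θ j * belowSnd θ Δ j.castSucc + weight Δ j * belowFst θ Δ j.castSucc := rfl

theorem belowFst_add_smul (θ Δ Δ' : Params n) (s : ℝ) (j : Fin (L + 1)) :
    belowFst θ (Δ + s • Δ') j = belowFst θ Δ j + s • belowFst θ Δ' j := by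
  induction j using Fin.induction with
  | zero => simp [belowFst_zero]
  | succ j ih =>
    rw [belowFst_succ, belowFst_succ, belowFst_succ, ih, weight_add, weight_smul, Matrix.mul_add,
      Matrix.add_mul, Matrix.mul_smul, Matrix.smul_mul, smul_add]
    abel

theorem sum_castSucc_lt_succ {M : Type*} [AddCommMonoid M] (g : Fin L → M) (k : Fin L) :
    (∑ i : Fin L, if i.castSucc < k.succ then g i else 0) =
      (∑ i : Fin L, if i.castSucc < k.castSucc then g i else 0) + g k := by
  have h : g k = ∑ i : Fin L, if i = k then g i else 0 := by simp
  rw [h, ← Finset.sum_add_distrib]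
  refine Finset.sum_congr rfl fun i _ => ?_
  rcases lt_trichotomy i k with hik | rfl | hik
  · have h1 : i.castSucc < k.succ := (Fin.castSucc_lt_castSucc_iff.2 hik).trans k.castSucc_lt_succ
    simp [h1, hik, hik.ne]
  · simp
  · have h1 : ¬ i.castSucc < k.succ := by
      rw [Fin.castSucc_lt_succ_iff]; exact not_le.2 hik
    simp [h1, hik.le, hik.ne']

/-- The factor `above θ k` completes every partial product, so the terms keep their form as `k`
grows and the induction closes. -/
theorem above_mul_belowFst (θ Δ : Params n) (k : Fin (L + 1)) : above θ k * belowFst θ Δ k =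
    ∑ i : Fin L, if i.castSucc < k then above θ i.succ * weight Δ i * below θ i.castSucc else 0 := by
  induction k using Fin.induction with
  | zero => simp [belowFst_zero]
  | succ k ih =>
    rw [sum_castSucc_lt_succ, ← ih, belowFst_succ, Matrix.mul_add, above_castSucc]
    simp only [Matrix.mul_assoc]

/-- Each pair of varied layers occurs once: the upper one is `i`, the lower one sits inside
`belowFst`. -/
theorem above_mul_belowSnd (θ Δ : Params n) (k : Fin (L + 1)) : above θ k * belowSnd θ Δ k =
    ∑ i : Fin L, if i.castSucc < k then
      above θ i.succ * weight Δ i * belowFst θ Δ i.castSucc else 0 := by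
  induction k using Fin.induction with
  | zero => simp [belowSnd_zero]
  | succ k ih =>
    rw [sum_castSucc_lt_succ, ← ih, belowSnd_succ, Matrix.mul_add, above_castSucc]
    simp only [Matrix.mul_assoc]

theorem belowFst_last (θ Δ : Params n) : belowFst θ Δ (Fin.last L) =
    ∑ i : Fin L, above θ i.succ * weight Δ i * below θ i.castSucc := by
  have h := above_mul_belowFst θ Δ (Fin.last L)
  rw [above_last, Matrix.one_mul] at h
  simpa [Fin.castSucc_lt_last] using h

theorem belowSnd_last (θ Δ : Params n) : belowSnd θ Δ (Fin.last L) =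
    ∑ i : Fin L, above θ i.succ * weight Δ i * belowFst θ Δ i.castSucc := by
  have h := above_mul_belowSnd θ Δ (Fin.last L)
  rw [above_last, Matrix.one_mul] at h
  simpa [Fin.castSucc_lt_last] using h

theorem above_mul_belowFst_layerDir (θ : Params n) {i j : Fin L} (hij : i < j)
    (X : Matrix (Fin (n i.succ)) (Fin (n i.castSucc)) ℝ) :
    above θ j.castSucc * belowFst θ (layerDir i X) j.castSucc =
      above θ i.succ * X * below θ i.castSucc := by
  rw [above_mul_belowFst, Finset.sum_eq_single i]
  · simp [hij, weight_layerDir_self]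
  · intro b _ hb; simp [weight_layerDir_of_ne hb]
  · simp

/-! ### Derivatives along lines -/

theorem hasDerivAt_weight (θ Δ : Params n) (j : Fin L) (t : ℝ) (a : Fin (n j.succ))
    (b : Fin (n j.castSucc)) :
    HasDerivAt (fun t : ℝ => weight (θ + t • Δ) j a b) (weight Δ j a b) t := by
  have : (fun t : ℝ => weight (θ + t • Δ) j a b) = fun t => weight θ j a b + t * weight Δ j a b :=
    rfl
  rw [this]
  simpa using ((hasDerivAt_id t).mul_const (weight Δ j a b)).const_add (weight θ j a b)

theorem hasDerivAt_below (θ Δ : Params n) (j : Fin (L + 1)) (t : ℝ) (a : Fin (n j))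
    (b : Fin (n 0)) :
    HasDerivAt (fun t : ℝ => below (θ + t • Δ) j a b) (belowFst (θ + t • Δ) Δ j a b) t := by
  induction j using Fin.induction generalizing b with
  | zero => simpa [below_zero, belowFst_zero] using hasDerivAt_const t _
  | succ j ih =>
    have h := hasDerivAt_matrix_mul (A := fun t : ℝ => weight (θ + t • Δ) j)
      (B := fun t : ℝ => below (θ + t • Δ) j.castSucc) (hasDerivAt_weight θ Δ j t)
      (fun a b => ih a b) a b
    simp only [below_succ, belowFst_succ]
    rwa [add_comm (_ * _)] at h

theorem hasDerivAt_belowFst (θ Δ : Params n) (j : Fin (L + 1)) (t : ℝ) (a : Fin (n j))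
    (b : Fin (n 0)) :
    HasDerivAt (fun t : ℝ => belowFst (θ + t • Δ) Δ j a b)
      (((2 : ℝ) • belowSnd (θ + t • Δ) Δ j) a b) t := by
  induction j using Fin.induction generalizing b with
  | zero => simpa [belowSnd_zero, belowFst_zero] using hasDerivAt_const t _
  | succ j ih =>
    have h := hasDerivAt_matrix_mul (A := fun t : ℝ => weight (θ + t • Δ) j)
      (B := fun t : ℝ => belowFst (θ + t • Δ) Δ j.castSucc) (hasDerivAt_weight θ Δ j t)
      (fun a b => ih a b) a b
    have h' := hasDerivAt_matrix_mul (A := fun _ : ℝ => weight Δ j)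
      (B := fun t : ℝ => below (θ + t • Δ) j.castSucc) (A' := 0) (t := t)
      (fun a b => hasDerivAt_const t _) (fun a b => hasDerivAt_below θ Δ j.castSucc t a b) a b
    have h2 := h.add h'
    simp only [belowFst_succ, belowSnd_succ]
    convert! h2 using 1
    simp only [Matrix.zero_mul, Matrix.mul_smul, Matrix.add_apply, Matrix.smul_apply,
      Matrix.zero_apply, smul_eq_mul]
    ring

theorem contDiff_below (j : Fin (L + 1)) (a : Fin (n j)) (b : Fin (n 0)) :
    ContDiff ℝ ω fun θ : Params n => below θ j a b := by
  induction j using Fin.induction with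
  | zero => simpa [below_zero] using contDiff_const
  | succ j ih =>
    simp only [below_succ, Matrix.mul_apply]
    refine ContDiff.sum fun c _ => ContDiff.mul ?_ (ih c)
    exact (EuclideanSpace.proj (𝕜 := ℝ) (⟨j, a, c⟩ : Σ j : Fin L, Fin (n j.succ) ×
      Fin (n j.castSucc))).contDiff

/-- The mean of `‖M xᵢ‖²` is the trace of `M (1/N ∑ xᵢ xᵢᵀ) Mᵀ`, and the data covariance is the
identity. -/
theorem loss_eq_frob {N : ℕ} (R : Matrix (Fin (n (Fin.last L))) (Fin (n 0)) ℝ)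
    (x : Fin N → EuclideanSpace ℝ (Fin (n 0)))
    (hx : (1 / (N : ℝ)) • ∑ i, Matrix.vecMulVec (x i) (x i) = 1) (θ : Params n) :
    loss R x θ = 1 / 2 * frob (network θ - R) (network θ - R) := by
  set M := network θ - R with hM
  have h1 : ∀ i, ‖Matrix.toEuclideanLin R (x i) - Matrix.toEuclideanLin (network θ) (x i)‖ ^ 2 =
      ∑ a, ∑ b, ∑ c, M a b * M a c * (x i b * x i c) := by
    intro i
    rw [norm_sub_rev, ← LinearMap.sub_apply, ← map_sub, ← hM, EuclideanSpace.norm_sq_eq]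
    refine Finset.sum_congr rfl fun a _ => ?_
    rw [Real.norm_eq_abs, sq_abs, Matrix.toLpLin_apply]
    simp only [Matrix.mulVec, dotProduct]
    rw [pow_two, Finset.sum_mul_sum]
    exact Finset.sum_congr rfl fun b _ => Finset.sum_congr rfl fun c _ => by ring
  have h2 : ∀ b c, 1 / (N : ℝ) * ∑ i, x i b * x i c = (1 : Matrix _ _ ℝ) b c := by
    intro b c
    rw [← hx]
    simp [Matrix.sum_apply, Matrix.vecMulVec_apply]
  rw [loss]
  simp only [h1]
  have h3 : ∑ i, ∑ a, ∑ b, ∑ c, M a b * M a c * (x i b * x i c) =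
      ∑ a, ∑ b, ∑ c, M a b * M a c * ∑ i, x i b * x i c := by
    simp only [Finset.mul_sum]
    rw [Finset.sum_comm]
    refine Finset.sum_congr rfl fun a _ => ?_
    rw [Finset.sum_comm]
    refine Finset.sum_congr rfl fun b _ => ?_
    rw [Finset.sum_comm]
  rw [h3, one_div, mul_inv, mul_assoc, Finset.mul_sum, ← one_div, frob]
  congr 1
  refine Finset.sum_congr rfl fun a _ => ?_
  rw [Finset.mul_sum]
  refine Finset.sum_congr rfl fun b _ => ?_
  rw [Finset.mul_sum, Finset.sum_eq_single b]
  · have := h2 b b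
    rw [Matrix.one_apply_eq, one_div] at this
    rw [mul_left_comm, this, mul_one]
  · intro c _ hc
    have := h2 b c
    rw [Matrix.one_apply_ne hc.symm, one_div] at this
    rw [mul_left_comm, this, mul_zero]
  · simp

/-- The Hessian quadratic form of the squared Frobenius distance to `R`. -/
noncomputable def hessForm (R : Matrix (Fin (n (Fin.last L))) (Fin (n 0)) ℝ) (θ Δ : Params n) :
    ℝ :=
  frob (belowFst θ Δ (Fin.last L)) (belowFst θ Δ (Fin.last L)) +
    2 * frob (network θ - R) (belowSnd θ Δ (Fin.last L))

variable {N : ℕ} {R : Matrix (Fin (n (Fin.last L))) (Fin (n 0)) ℝ}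
  {x : Fin N → EuclideanSpace ℝ (Fin (n 0))}

theorem contDiff_loss (hx : (1 / (N : ℝ)) • ∑ i, Matrix.vecMulVec (x i) (x i) = 1) :
    ContDiff ℝ ω (loss (n := n) R x) := by
  have h : loss (n := n) R x = fun θ => 1 / 2 * frob (network θ - R) (network θ - R) :=
    funext (loss_eq_frob R x hx)
  rw [h]
  simp only [frob, Matrix.sub_apply]
  have h1 : ∀ a b, ContDiff ℝ ω fun θ : Params n => network θ a b - R a b := fun a b =>
    (contDiff_below (Fin.last L) a b).sub contDiff_const
  exact contDiff_const.mul (ContDiff.sum fun a _ => ContDiff.sum fun b _ => (h1 a b).mul (h1 a b))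

theorem loss_variations (hx : (1 / (N : ℝ)) • ∑ i, Matrix.vecMulVec (x i) (x i) = 1)
    (θ Δ : Params n) :
    ⟪gradient (loss R x) θ, Δ⟫ = frob (network θ - R) (belowFst θ Δ (Fin.last L)) ∧
      ⟪fderiv ℝ (gradient (loss R x)) θ Δ, Δ⟫ = hessForm R θ Δ := by
  have hnet : ∀ t : ℝ, ∀ a b, HasDerivAt (fun t : ℝ => (network (θ + t • Δ) - R) a b)
      (belowFst (θ + t • Δ) Δ (Fin.last L) a b) t := fun t a b =>
    (hasDerivAt_below θ Δ (Fin.last L) t a b).sub_const _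
  have h1 : ∀ t : ℝ, HasDerivAt (fun t : ℝ => loss R x (θ + t • Δ))
      (frob (network (θ + t • Δ) - R) (belowFst (θ + t • Δ) Δ (Fin.last L))) t := by
    intro t
    simp only [loss_eq_frob R x hx]
    have h := (hasDerivAt_frob (hnet t) (hnet t)).const_mul (1 / 2 : ℝ)
    convert! h using 1
    rw [frob_comm (belowFst _ _ _)]
    ring
  have h2 := hasDerivAt_frob (hnet 0) (hasDerivAt_belowFst θ Δ (Fin.last L) 0)
  have h3 := variations_along_line (contDiff_loss hx) θ Δ h1 h2
  refine ⟨by simpa using h3.1, ?_⟩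
  rw [h3.2, zero_smul, add_zero, frob_smul_right, hessForm]

end Network

/-! ### Lower bound for the Hessian in the steepest direction -/

section Sharpness

variable {L : ℕ} {n : Fin (L + 1) → ℕ}

theorem norm_sq_eq_dotProduct {k : ℕ} (w : EuclideanSpace ℝ (Fin k)) :
    ‖w‖ ^ 2 = w.ofLp ⬝ᵥ w.ofLp := by
  rw [EuclideanSpace.norm_sq_eq]
  exact Finset.sum_congr rfl fun i _ => by rw [Real.norm_eq_abs, sq_abs, pow_two]

/-- The direction along which the network changes fastest in the entry `(u, v)`. -/
def steepDir (θ : Params n) (u : Fin (n (Fin.last L)) → ℝ) (v : Fin (n 0) → ℝ) : Params n :=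
  ofWeights fun j =>
    Matrix.vecMulVec ((above θ j.succ)ᵀ *ᵥ u) (below θ j.castSucc *ᵥ v)

theorem frob_vecMulVec_vecMulVec {l m : Type*} [Fintype l] [Fintype m] (a a' : l → ℝ)
    (b b' : m → ℝ) :
    frob (Matrix.vecMulVec a b) (Matrix.vecMulVec a' b') = (a ⬝ᵥ a') * (b ⬝ᵥ b') := by
  simp only [frob, Matrix.vecMulVec_apply, dotProduct, Finset.sum_mul_sum]
  exact Finset.sum_congr rfl fun _ _ => Finset.sum_congr rfl fun _ _ => by ring

theorem sharpnessSum_eq (θ : Params n) (u : EuclideanSpace ℝ (Fin (n (Fin.last L))))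
    (v : EuclideanSpace ℝ (Fin (n 0))) : sharpnessSum θ u v =
      ∑ j : Fin L, (((above θ j.succ)ᵀ *ᵥ u.ofLp) ⬝ᵥ ((above θ j.succ)ᵀ *ᵥ u.ofLp)) *
        ((below θ j.castSucc *ᵥ v.ofLp) ⬝ᵥ (below θ j.castSucc *ᵥ v.ofLp)) := by
  refine Finset.sum_congr rfl fun j _ => ?_
  rw [pNorm, qNorm, norm_sq_eq_dotProduct, norm_sq_eq_dotProduct, mul_comm]
  rfl

theorem norm_sq_steepDir (θ : Params n) (u : EuclideanSpace ℝ (Fin (n (Fin.last L))))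
    (v : EuclideanSpace ℝ (Fin (n 0))) :
    ‖steepDir θ u.ofLp v.ofLp‖ ^ 2 = sharpnessSum θ u v := by
  rw [norm_sq_eq_sum_frob, sharpnessSum_eq]
  exact Finset.sum_congr rfl fun j _ => by
    rw [steepDir, weight_ofWeights, frob_vecMulVec_vecMulVec]

theorem frob_mul_vecMulVec_mul {l m k o : Type*} [Fintype l] [Fintype m] [Fintype k] [Fintype o]
    (E : Matrix l m ℝ) (A : Matrix l k ℝ) (D : Matrix o m ℝ) (a : k → ℝ) (p : o → ℝ) :
    frob E (A * Matrix.vecMulVec a p * D) = p ⬝ᵥ D *ᵥ (Eᵀ *ᵥ (A *ᵥ a)) := by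
  rw [frob_mul_right, frob_mul_left, frob_vecMulVec, Matrix.mulVec_mulVec, Matrix.mulVec_mulVec,
    Matrix.dotProduct_mulVec p, dotProduct_comm _ a, ← Matrix.mulVec_transpose]
  simp [Matrix.mul_assoc]

/-- `steepDir` is the gradient of `uᵀ W_L ⋯ W_1 v`, so the derivative along it is its own squared
norm. -/
theorem frob_belowFst_steepDir (θ : Params n) (u : EuclideanSpace ℝ (Fin (n (Fin.last L))))
    (v : EuclideanSpace ℝ (Fin (n 0))) :
    frob (Matrix.vecMulVec u.ofLp v.ofLp)
      (belowFst θ (steepDir θ u.ofLp v.ofLp) (Fin.last L)) = sharpnessSum θ u v := by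
  rw [belowFst_last, frob_sum_right, sharpnessSum_eq]
  refine Finset.sum_congr rfl fun j _ => ?_
  rw [steepDir, weight_ofWeights, frob_mul_right, frob_mul_left, Matrix.vecMulVec_mul,
    Matrix.mul_vecMulVec, frob_vecMulVec_vecMulVec, ← Matrix.mulVec_transpose,
    Matrix.transpose_transpose]

theorem network_eq_mul (θ : Params n) (j : Fin L) :
    network θ = above θ j.succ * weight θ j * below θ j.castSucc := by
  rw [← above_castSucc, above_mul_below]

theorem belowFst_layerDir_last (θ : Params n) (j : Fin L)
    (X : Matrix (Fin (n j.succ)) (Fin (n j.castSucc)) ℝ) :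
    belowFst θ (layerDir j X) (Fin.last L) = above θ j.succ * X * below θ j.castSucc := by
  rw [belowFst_last, Finset.sum_eq_single j]
  · rw [weight_layerDir_self]
  · intro i _ hi; simp [weight_layerDir_of_ne hi]
  · simp

/-- A left inverse expresses `below θ 0 = 1` without transporting matrices along an equality of
indices. -/
theorem exists_mul_below_eq_one (θ : Params n) {k : Fin (L + 1)} (hk : k = 0) :
    ∃ C : Matrix (Fin (n 0)) (Fin (n k)) ℝ, C * below θ k = 1 := by
  subst hk
  exact ⟨1, Matrix.one_mul _⟩

theorem exists_above_mul_eq_one (θ : Params n) {k : Fin (L + 1)} (hk : k = Fin.last L) :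
    ∃ C : Matrix (Fin (n k)) (Fin (n (Fin.last L))) ℝ, above θ k * C = 1 := by
  subst hk
  exact ⟨1, by rw [above_last, Matrix.one_mul]⟩

section Critical

variable {R : Matrix (Fin (n (Fin.last L))) (Fin (n 0)) ℝ} {θ : Params n}

/-- The left side is the gradient in layer `j`; testing criticality on it gives its squared norm. -/
theorem above_transpose_mul_mul_below_transpose
    (hcrit : ∀ Δ, frob (network θ - R) (belowFst θ Δ (Fin.last L)) = 0) (j : Fin L) :
    (above θ j.succ)ᵀ * ((network θ - R) * (below θ j.castSucc)ᵀ) = 0 := by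
  have h := hcrit (layerDir j ((above θ j.succ)ᵀ * ((network θ - R) * (below θ j.castSucc)ᵀ)))
  rw [belowFst_layerDir_last, frob_mul_right, frob_mul_left] at h
  exact eq_zero_of_frob_self_eq_zero h

theorem network_transpose_mul_eq_zero (hL : 0 < L)
    (hcrit : ∀ Δ, frob (network θ - R) (belowFst θ Δ (Fin.last L)) = 0) :
    (network θ)ᵀ * (network θ - R) = 0 := by
  let j : Fin L := ⟨0, hL⟩
  obtain ⟨C, hC⟩ := exists_mul_below_eq_one θ (k := j.castSucc) rfl
  have h := congrArg (· * Cᵀ) (above_transpose_mul_mul_below_transpose hcrit j)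
  simp only [Matrix.mul_assoc, ← Matrix.transpose_mul, hC, Matrix.transpose_one, Matrix.mul_one,
    Matrix.zero_mul] at h
  rw [congrArg Matrix.transpose (network_eq_mul θ j), Matrix.mul_assoc (above θ j.succ),
    Matrix.transpose_mul, Matrix.mul_assoc, h, Matrix.mul_zero]

theorem mul_network_transpose_eq_zero (hL : 0 < L)
    (hcrit : ∀ Δ, frob (network θ - R) (belowFst θ Δ (Fin.last L)) = 0) :
    (network θ - R) * (network θ)ᵀ = 0 := by
  let j : Fin L := ⟨L - 1, by omega⟩
  obtain ⟨C, hC⟩ := exists_above_mul_eq_one θ (k := j.succ)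
    (by ext; simp only [j, Fin.val_succ, Fin.val_last]; omega)
  have h := congrArg (Cᵀ * ·) (above_transpose_mul_mul_below_transpose hcrit j)
  simp only [← Matrix.mul_assoc, ← Matrix.transpose_mul, hC, Matrix.transpose_one, Matrix.one_mul,
    Matrix.mul_zero] at h
  rw [congrArg Matrix.transpose (network_eq_mul θ j), Matrix.transpose_mul, ← Matrix.mul_assoc, h,
    Matrix.zero_mul]

end Critical

/-- Keeps every first variation a multiple of `vᵀ` on the right, so that a residual annihilating `v`
kills the mixed terms. -/
theorem belowFst_layerDir_vecMulVec (θ : Params n) {j : Fin L} {p : Fin (n j.succ) → ℝ}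
    {d : Fin (n j.castSucc) → ℝ} {v : Fin (n 0) → ℝ} (hd : d ᵥ* below θ j.castSucc = v)
    (k : Fin (L + 1)) :
    ∃ w, belowFst θ (layerDir j (Matrix.vecMulVec p d)) k = Matrix.vecMulVec w v := by
  induction k using Fin.induction with
  | zero => exact ⟨0, by rw [belowFst_zero]; ext; simp [Matrix.vecMulVec_apply]⟩
  | succ k ih =>
    obtain ⟨w, hw⟩ := ih
    rw [belowFst_succ, hw, Matrix.mul_vecMulVec]
    by_cases hk : k = j
    · subst hk
      rw [weight_layerDir_self, Matrix.vecMulVec_mul, hd, ← Matrix.add_vecMulVec]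
      exact ⟨_, rfl⟩
    · rw [weight_layerDir_of_ne hk, Matrix.zero_mul, add_zero]
      exact ⟨_, rfl⟩

/-- At a critical point with positive semidefinite Hessian, the Hessian dominates the square of
the first variation along any pair of singular vectors with a positive singular value. -/
theorem sq_le_hessForm_of_pos {R : Matrix (Fin (n (Fin.last L))) (Fin (n 0)) ℝ} {θ : Params n}
    (hL : 0 < L)
    (hcrit : ∀ Δ, frob (network θ - R) (belowFst θ Δ (Fin.last L)) = 0)
    (hpsd : ∀ Δ, 0 ≤ hessForm R θ Δ) {u : Fin (n (Fin.last L)) → ℝ} {v : Fin (n 0) → ℝ} {σ : ℝ}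
    (hσ : 0 < σ) (hu : u ⬝ᵥ u = 1) (hv : v ⬝ᵥ v = 1) (huv : network θ *ᵥ v = σ • u)
    (hvu : (network θ)ᵀ *ᵥ u = σ • v) (Δ : Params n) :
    frob (Matrix.vecMulVec u v) (belowFst θ Δ (Fin.last L)) ^ 2 ≤ hessForm R θ Δ := by
  set E := network θ - R with hEdef
  have hEu : Eᵀ *ᵥ u = 0 := by
    have h2 : Eᵀ * network θ = 0 := by
      rw [← Matrix.transpose_transpose (network θ), ← Matrix.transpose_mul,
        network_transpose_mul_eq_zero hL hcrit, Matrix.transpose_zero]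
    have h3 : σ • (Eᵀ *ᵥ u) = 0 := by
      rw [← Matrix.mulVec_smul, ← huv, Matrix.mulVec_mulVec, h2, Matrix.zero_mulVec]
    exact (smul_eq_zero.1 h3).resolve_left hσ.ne'
  have hEv : E *ᵥ v = 0 := by
    have h3 : σ • (E *ᵥ v) = 0 := by
      rw [← Matrix.mulVec_smul, ← hvu, Matrix.mulVec_mulVec,
        mul_network_transpose_eq_zero hL hcrit, Matrix.zero_mulVec]
    exact (smul_eq_zero.1 h3).resolve_left hσ.ne'
  let j : Fin L := ⟨0, hL⟩
  -- With these vectors a rank-one change of one layer moves the network exactly along `uvᵀ`, with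
  -- speed `σ²`.
  set p := (weight θ j * below θ j.castSucc) *ᵥ v with hp
  set d := (above θ j.succ * weight θ j)ᵀ *ᵥ u with hd
  have hAp : above θ j.succ *ᵥ p = σ • u := by
    rw [hp, Matrix.mulVec_mulVec, ← Matrix.mul_assoc, ← network_eq_mul, huv]
  have hdB : d ᵥ* below θ j.castSucc = σ • v := by
    rw [hd, ← Matrix.mulVec_transpose, Matrix.mulVec_mulVec, ← Matrix.transpose_mul,
      ← network_eq_mul, hvu]
  set Z : Params n := layerDir j (Matrix.vecMulVec p d) with hZ
  have hZ1 : belowFst θ Z (Fin.last L) = σ ^ 2 • Matrix.vecMulVec u v := by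
    rw [hZ, belowFst_layerDir_last, Matrix.mul_vecMulVec, Matrix.vecMulVec_mul, hAp, hdB,
      Matrix.vecMulVec_smul, Matrix.smul_vecMulVec, smul_smul, pow_two]
  -- Terms with `Z` in the upper layer vanish by `Eᵀu = 0`, those with `Z` in the lower layer by `Ev
  -- = 0`.
  have hZ2 : ∀ s : ℝ, frob E (belowSnd θ (Δ + s • Z) (Fin.last L)) =
      frob E (belowSnd θ Δ (Fin.last L)) := by
    intro s
    rw [belowSnd_last, belowSnd_last, frob_sum_right, frob_sum_right]
    refine Finset.sum_congr rfl fun i _ => ?_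
    have h1 : frob E (above θ i.succ * weight Z i *
        belowFst θ (Δ + s • Z) i.castSucc) = 0 := by
      by_cases hi : i = j
      · subst hi
        rw [hZ, weight_layerDir_self, Matrix.mul_vecMulVec, Matrix.vecMulVec_mul, hAp,
          frob_vecMulVec, smul_dotProduct, Matrix.dotProduct_mulVec, ← Matrix.mulVec_transpose, hEu,
          zero_dotProduct, smul_zero]
      · rw [hZ, weight_layerDir_of_ne hi, Matrix.mul_zero, Matrix.zero_mul, frob_zero_right]
    have h2 : frob E (above θ i.succ * weight Δ i * belowFst θ Z i.castSucc) = 0 := by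
      obtain ⟨w, hw⟩ := belowFst_layerDir_vecMulVec θ (p := p) hdB i.castSucc
      rw [hZ, hw, Matrix.mul_vecMulVec, frob_vecMulVec, Matrix.mulVec_smul, hEv, smul_zero,
        dotProduct_zero]
    rw [weight_add, weight_smul, Matrix.mul_add, Matrix.add_mul, frob_add_right, Matrix.mul_smul,
      Matrix.smul_mul, frob_smul_right, h1, mul_zero, add_zero, belowFst_add_smul, Matrix.mul_add,
      frob_add_right, Matrix.mul_smul, frob_smul_right, h2, mul_zero, add_zero]
  set b := frob (Matrix.vecMulVec u v) (belowFst θ Δ (Fin.last L)) with hb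
  -- This multiple removes the `uvᵀ` component of the first variation, which lowers the Hessian form
  -- by exactly `b²`.
  have h := hpsd (Δ + (-(b / σ ^ 2)) • Z)
  have hff : frob (Matrix.vecMulVec u v) (Matrix.vecMulVec u v) = 1 := by
    rw [frob_vecMulVec_vecMulVec, hu, hv, mul_one]
  rw [hessForm, ← hEdef, hZ2, belowFst_add_smul, hZ1, smul_smul] at h
  have e1 : -(b / σ ^ 2) * σ ^ 2 = -b := by field_simp
  rw [e1, frob_add_self, frob_smul_right, frob_smul_right, frob_comm (-b • _), frob_smul_right,
    frob_comm (belowFst _ _ _) (Matrix.vecMulVec u v), ← hb, hff] at h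
  rw [hessForm, ← hEdef]
  nlinarith

theorem belowFst_layerDir_eq_zero (θ : Params n) {j : Fin L} {b : Fin (n j.succ) → ℝ}
    {d : Fin (n j.castSucc) → ℝ} (hd : d ᵥ* below θ j.castSucc = 0) (k : Fin (L + 1)) :
    belowFst θ (layerDir j (Matrix.vecMulVec b d)) k = 0 := by
  induction k using Fin.induction with
  | zero => rfl
  | succ k ih =>
    rw [belowFst_succ, ih, Matrix.mul_zero, zero_add]
    by_cases hk : k = j
    · subst hk
      rw [weight_layerDir_self, Matrix.vecMulVec_mul, hd]
      ext; simp [Matrix.vecMulVec_apply]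
    · rw [weight_layerDir_of_ne hk, Matrix.zero_mul]

/-- The added direction has no first variation at any depth, so no `s²` term arises; a form bounded
below then forces the slope to vanish. -/
theorem hessForm_add_smul_layerDir (R : Matrix (Fin (n (Fin.last L))) (Fin (n 0)) ℝ)
    (θ Δ : Params n) {j : Fin L} {b : Fin (n j.succ) → ℝ} {d : Fin (n j.castSucc) → ℝ}
    (hd : d ᵥ* below θ j.castSucc = 0) (s : ℝ) :
    hessForm R θ (Δ + s • layerDir j (Matrix.vecMulVec b d)) = hessForm R θ Δ +
      s * (2 * frob (network θ - R)
        (above θ j.succ * Matrix.vecMulVec b d * belowFst θ Δ j.castSucc)) := by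
  have h1 : ∀ k, belowFst θ (Δ + s • layerDir j (Matrix.vecMulVec b d)) k = belowFst θ Δ k := by
    intro k
    rw [belowFst_add_smul, belowFst_layerDir_eq_zero θ hd, smul_zero, add_zero]
  have h2 : belowSnd θ (Δ + s • layerDir j (Matrix.vecMulVec b d)) (Fin.last L) =
      belowSnd θ Δ (Fin.last L) +
        s • (above θ j.succ * Matrix.vecMulVec b d * belowFst θ Δ j.castSucc) := by
    rw [belowSnd_last, belowSnd_last]
    simp only [h1, weight_add, weight_smul, Matrix.mul_add, Matrix.add_mul, Finset.sum_add_distrib,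
      Matrix.mul_smul, Matrix.smul_mul]
    congr 1
    rw [Finset.sum_eq_single j]
    · rw [weight_layerDir_self]
    · intro i _ hi; simp [weight_layerDir_of_ne hi]
    · simp
  rw [hessForm, hessForm, h1, h2, frob_add_right, frob_smul_right]
  ring

/-- If the network vanishes where the Hessian is positive semidefinite, the mixed second variations
along two layers vanish after multiplication by the layers above the lower one. -/
theorem above_mul_belowFst_mul_eq_zero {R : Matrix (Fin (n (Fin.last L))) (Fin (n 0)) ℝ}
    {θ : Params n} (hθ : network θ = 0) (hpsd : ∀ Δ, 0 ≤ hessForm R θ Δ) (Δ : Params n)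
    (j : Fin L) (b : Fin (n j.succ) → ℝ) :
    (above θ j.castSucc * belowFst θ Δ j.castSucc) *ᵥ
      ((network θ - R)ᵀ *ᵥ (above θ j.succ *ᵥ b)) = 0 := by
  set w := (above θ j.castSucc * belowFst θ Δ j.castSucc) *ᵥ
      ((network θ - R)ᵀ *ᵥ (above θ j.succ *ᵥ b)) with hw
  -- The row vector `wᵀ W_L ⋯ W_{j+1}` is admissible because the whole network is zero, and it turns
  -- the slope into a multiple of `w ⬝ᵥ w`.
  have hd : (w ᵥ* above θ j.castSucc) ᵥ* below θ j.castSucc = 0 := by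
    rw [Matrix.vecMul_vecMul, above_mul_below, hθ, Matrix.vecMul_zero]
  have h : ∀ s : ℝ, 0 ≤ hessForm R θ Δ + s * (2 * (w ⬝ᵥ w)) := by
    intro s
    have := hpsd (Δ + s • layerDir j (Matrix.vecMulVec b (w ᵥ* above θ j.castSucc)))
    rwa [hessForm_add_smul_layerDir R θ Δ hd, frob_mul_vecMulVec_mul, ← Matrix.dotProduct_mulVec,
      Matrix.mulVec_mulVec, ← hw] at this
  by_contra hne
  have hpos : 0 < w ⬝ᵥ w := lt_of_le_of_ne (Finset.sum_nonneg fun _ _ => mul_self_nonneg _)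
    fun h0 => hne (dotProduct_self_eq_zero.1 h0.symm)
  have := h (-((hessForm R θ Δ + 1) / (2 * (w ⬝ᵥ w))))
  rw [neg_mul, div_mul_cancel₀ _ (by positivity)] at this
  linarith

theorem sq_le_hessForm_of_network_eq_zero {R : Matrix (Fin (n (Fin.last L))) (Fin (n 0)) ℝ}
    {θ : Params n} (hθ : network θ = 0) (hpsd : ∀ Δ, 0 ≤ hessForm R θ Δ)
    {u : Fin (n (Fin.last L)) → ℝ} {v : Fin (n 0) → ℝ} (hu : u ⬝ᵥ u = 1) (hv : v ⬝ᵥ v = 1) :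
    frob (Matrix.vecMulVec u v) (belowFst θ (steepDir θ u v) (Fin.last L)) ^ 2 ≤
      hessForm R θ (steepDir θ u v) := by
  set T := steepDir θ u v with hT
  have hsnd : frob (network θ - R) (belowSnd θ T (Fin.last L)) = 0 := by
    rw [belowSnd_last, frob_sum_right]
    refine Finset.sum_eq_zero fun j _ => ?_
    have hTw : ∀ i, weight T i =
        Matrix.vecMulVec ((above θ i.succ)ᵀ *ᵥ u) (below θ i.castSucc *ᵥ v) := fun i => rfl
    rw [hTw, frob_mul_vecMulVec_mul]
    set y := (network θ - R)ᵀ *ᵥ (above θ j.succ *ᵥ ((above θ j.succ)ᵀ *ᵥ u)) with hy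
    -- The mixed variation of layers `i < j` vanishes only after multiplication by the layers above
    -- `i`; the special form of `T` permits removing that factor.
    have hlow : ∀ i : Fin L, i < j → weight T i *ᵥ (below θ i.castSucc *ᵥ y) = 0 := by
      intro i hij
      have h := above_mul_belowFst_mul_eq_zero hθ hpsd (layerDir i (weight T i)) j
        ((above θ j.succ)ᵀ *ᵥ u)
      rw [above_mul_belowFst_layerDir θ hij, ← hy, hTw, Matrix.mul_vecMulVec, ← Matrix.mulVec_mulVec,
        Matrix.vecMulVec_mulVec] at h
      rw [hTw, Matrix.vecMulVec_mulVec]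
      set c := (below θ i.castSucc *ᵥ v) ⬝ᵥ (below θ i.castSucc *ᵥ y)
      set a := (above θ i.succ)ᵀ *ᵥ u with ha
      rw [op_smul_eq_smul] at h ⊢
      -- Pairing with `u` gives `c ‖a‖² = 0`, hence `c • a = 0`.
      have h1 : u ⬝ᵥ (c • (above θ i.succ *ᵥ a)) = 0 := by rw [h, dotProduct_zero]
      rw [dotProduct_smul, Matrix.dotProduct_mulVec, ← Matrix.mulVec_transpose, ← ha, smul_eq_mul,
        mul_eq_zero, dotProduct_self_eq_zero] at h1
      rcases h1 with h1 | h1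
      · rw [h1, zero_smul]
      · rw [h1, smul_zero]
    have hk : ∀ k : Fin (L + 1), k ≤ j.castSucc → belowFst θ T k *ᵥ y = 0 := by
      intro k
      induction k using Fin.induction with
      | zero => intro _; rw [belowFst_zero, Matrix.zero_mulVec]
      | succ k ih =>
        intro hk
        have hkj : k.castSucc < j.castSucc := k.castSucc_lt_succ.trans_le hk
        rw [belowFst_succ, Matrix.add_mulVec, ← Matrix.mulVec_mulVec, ih hkj.le,
          Matrix.mulVec_zero, zero_add, ← Matrix.mulVec_mulVec,
          hlow k (Fin.castSucc_lt_castSucc_iff.1 hkj)]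
    rw [hk _ le_rfl, dotProduct_zero]
  rw [hessForm, hsnd, mul_zero, add_zero]
  have h := frob_sq_le (Matrix.vecMulVec u v) (belowFst θ T (Fin.last L))
  rwa [frob_vecMulVec_vecMulVec, hu, hv, one_mul, one_mul] at h

end Sharpness

/-! ### A point where the gradient step has nonzero Jacobian -/

section Nondegenerate

theorem exists_transpose_mul_self_eq_one {p q : ℕ} (h : p ≤ q) :
    ∃ J : Matrix (Fin q) (Fin p) ℝ, Jᵀ * J = 1 := by
  refine ⟨(1 : Matrix (Fin q) (Fin q) ℝ).submatrix id (Fin.castLE h), ?_⟩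
  ext i j
  simp [Matrix.mul_apply, Matrix.one_apply]

/-- The Hessian quadratic form of a network with two layers. -/
def twoLayerForm {p q r : Type*} [Fintype p] [Fintype q] [Fintype r] (R : Matrix r p ℝ)
    (W₁ : Matrix q p ℝ) (W₂ : Matrix r q ℝ) (D₁ : Matrix q p ℝ) (D₂ : Matrix r q ℝ) : ℝ :=
  frob (W₂ * D₁ + D₂ * W₁) (W₂ * D₁ + D₂ * W₁) + 2 * frob (W₂ * W₁ - R) (D₂ * D₁)

/-- The two hypotheses on `(D₁, D₂)` are the eigenvector equation for the eigenvalue `1 / δ`, in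
polarized and diagonal form. The origin may fail here, since there `R` couples the two layers. A
first layer equal to `s` times an isometry or its transpose, with `δ s² > 1`, works. -/
theorem exists_twoLayer_nondegenerate {p q r : ℕ} (R : Matrix (Fin r) (Fin p) ℝ) {δ : ℝ}
    (hδ : 0 < δ) : ∃ (W₁ : Matrix (Fin q) (Fin p) ℝ) (W₂ : Matrix (Fin r) (Fin q) ℝ),
      ∀ D₁ D₂, (∀ D₁' D₂', 2 * (frob D₁ D₁' + frob D₂ D₂') =
        δ * (twoLayerForm R W₁ W₂ (D₁ + D₁') (D₂ + D₂') - twoLayerForm R W₁ W₂ D₁ D₂ -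
          twoLayerForm R W₁ W₂ D₁' D₂')) →
      frob D₁ D₁ + frob D₂ D₂ = δ * twoLayerForm R W₁ W₂ D₁ D₂ →
      frob D₁ D₁ + frob D₂ D₂ = 0 := by
  obtain ⟨s, hs0, hs⟩ : ∃ s : ℝ, 0 < s ∧ 1 < δ * s ^ 2 := by
    refine ⟨1 + 1 / δ, by positivity, ?_⟩
    have : δ * (1 + 1 / δ) ^ 2 = δ + 2 + 1 / δ := by field_simp; ring
    rw [this]
    have : 0 < 1 / δ := by positivity
    linarith
  rcases le_total p q with hpq | hqp
  · obtain ⟨J, hJ⟩ := exists_transpose_mul_self_eq_one hpq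
    refine ⟨s • J, s⁻¹ • (R * Jᵀ), fun D₁ D₂ hbil hquad => ?_⟩
    set W₁ := s • J with hW₁
    set W₂ := s⁻¹ • (R * Jᵀ) with hW₂
    have h1 : W₁ᵀ * W₁ = s ^ 2 • (1 : Matrix (Fin p) (Fin p) ℝ) := by
      rw [hW₁, Matrix.transpose_smul, Matrix.smul_mul, Matrix.mul_smul, hJ, smul_smul, pow_two]
    have h2 : W₂ * W₁ = R := by
      rw [hW₁, hW₂, Matrix.smul_mul, Matrix.mul_smul, Matrix.mul_assoc, hJ, Matrix.mul_one,
        smul_smul, inv_mul_cancel₀ hs0.ne', one_smul]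
    have hf : ∀ D₁ D₂, twoLayerForm R W₁ W₂ D₁ D₂ =
        frob (W₂ * D₁ + D₂ * W₁) (W₂ * D₁ + D₂ * W₁) := fun D₁ D₂ => by
      rw [twoLayerForm, h2, sub_self, frob_comm 0, frob_zero_right, mul_zero, add_zero]
    set y := W₂ * D₁ + D₂ * W₁ with hy
    -- The adjoint of the first variation applied to `y`. The equation becomes `‖y‖² = δ (‖W₂ᵀ y‖² +
    -- s² ‖y‖²)`, so `y = 0`.
    have hb := hbil (W₂ᵀ * y) (y * W₁ᵀ)
    have hy' : W₂ * (D₁ + W₂ᵀ * y) + (D₂ + y * W₁ᵀ) * W₁ =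
        y + (W₂ * (W₂ᵀ * y) + y * W₁ᵀ * W₁) := by
      rw [Matrix.mul_add, Matrix.add_mul, hy]; abel
    set y' := W₂ * (W₂ᵀ * y) + y * W₁ᵀ * W₁ with hy'd
    have eB : frob D₁ (W₂ᵀ * y) + frob D₂ (y * W₁ᵀ) = frob y y := by
      rw [frob_mul_left, Matrix.transpose_transpose, frob_mul_right, Matrix.transpose_transpose,
        frob_comm _ y, frob_comm _ y, ← frob_add_right, ← hy]
    rw [hf, hf, hf, hy', ← hy, ← hy'd, frob_add_self, eB] at hb
    have e1 : frob y y' = frob (W₂ᵀ * y) (W₂ᵀ * y) + s ^ 2 * frob y y := by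
      rw [hy'd, frob_add_right, frob_mul_left, Matrix.mul_assoc, h1, Matrix.mul_smul,
        Matrix.mul_one, frob_smul_right]
    rw [e1] at hb
    have h3 := frob_self_nonneg (W₂ᵀ * y)
    have h4 := frob_self_nonneg y
    have h5 : frob y y = 0 := by nlinarith
    rw [hquad, hf, ← hy, h5, mul_zero]
  · obtain ⟨J, hJ⟩ := exists_transpose_mul_self_eq_one hqp
    refine ⟨s • Jᵀ, 0, fun D₁ D₂ hbil hquad => ?_⟩
    have hf : ∀ D₁ D₂, twoLayerForm R (s • Jᵀ) 0 D₁ D₂ =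
        s ^ 2 * frob D₂ D₂ - 2 * frob R (D₂ * D₁) := fun D₁ D₂ => by
      have e1 : frob (D₂ * s • Jᵀ) (D₂ * s • Jᵀ) = s ^ 2 * frob D₂ D₂ := by
        rw [Matrix.mul_smul, frob_smul_right, frob_comm, frob_smul_right, frob_mul_right,
          Matrix.transpose_transpose, Matrix.mul_assoc, hJ, Matrix.mul_one]
        ring
      have e2 : frob (-R) (D₂ * D₁) = - frob R (D₂ * D₁) := by
        simp [frob]
      rw [twoLayerForm, Matrix.zero_mul, Matrix.zero_mul, zero_add, zero_sub, e1, e2]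
      ring
    -- This gives `‖D₁‖² = -δ ⟨R, D₂ D₁⟩`; substituted into the diagonal equation it leaves `‖D₁‖² +
    -- (δ s² - 1) ‖D₂‖² = 0`.
    have hb := hbil D₁ 0
    rw [hf, hf, hf, add_zero, Matrix.mul_add, frob_add_right, frob_zero_right, frob_zero_right,
      Matrix.zero_mul, frob_zero_right] at hb
    rw [hf] at hquad
    have h3 := frob_self_nonneg D₁
    have h4 := frob_self_nonneg D₂
    have h5 : frob D₂ D₂ = 0 := by nlinarith
    have h6 : frob D₁ D₁ = 0 := by rw [h5] at hquad; linarith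
    rw [h5, h6, add_zero]

theorem below_zero_param {L : ℕ} {n : Fin (L + 1) → ℕ} {k : Fin (L + 1)} (hk : k ≠ 0) :
    below (0 : Params n) k = 0 := by
  obtain ⟨j, rfl⟩ := Fin.exists_succ_eq.2 hk
  rw [below_succ]
  exact Matrix.zero_mul _

theorem above_zero_param {L : ℕ} {n : Fin (L + 1) → ℕ} {k : Fin (L + 1)} (hk : k ≠ Fin.last L) :
    above (0 : Params n) k = 0 := by
  obtain ⟨j, rfl⟩ := Fin.exists_castSucc_eq.2 hk
  rw [above_castSucc]
  exact Matrix.mul_zero _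

/-- Varying at most two of three or more layers at the origin leaves a zero factor in the product.
-/
theorem hessForm_zero_of_three_le {L : ℕ} {n : Fin (L + 1) → ℕ} (hL : 3 ≤ L)
    (R : Matrix (Fin (n (Fin.last L))) (Fin (n 0)) ℝ) (Δ : Params n) : hessForm R 0 Δ = 0 := by
  have h1 : belowFst 0 Δ (Fin.last L) = 0 := by
    rw [belowFst_last]
    refine Finset.sum_eq_zero fun i _ => ?_
    by_cases hi : i.castSucc = 0
    · have : i.succ ≠ Fin.last L := by
        intro h
        have h1 := congrArg Fin.val hi
        have h2 := congrArg Fin.val h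
        simp only [Fin.val_castSucc, Fin.val_zero, Fin.val_succ, Fin.val_last] at h1 h2
        omega
      rw [above_zero_param this, Matrix.zero_mul, Matrix.zero_mul]
    · rw [below_zero_param hi, Matrix.mul_zero]
  have h2 : belowSnd 0 Δ (Fin.last L) = 0 := by
    rw [belowSnd_last]
    refine Finset.sum_eq_zero fun i _ => ?_
    by_cases hi : i.succ = Fin.last L
    · have h2 : (i : ℕ) + 1 = L := by simpa using congrArg Fin.val hi
      have hi0 : i.castSucc ≠ 0 := by
        intro h
        have h1 : (i : ℕ) = 0 := by simpa using congrArg Fin.val h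
        omega
      obtain ⟨j, hj⟩ := Fin.exists_succ_eq.2 hi0
      have hj0 : j.castSucc ≠ 0 := by
        intro h
        have h1 : (j : ℕ) = 0 := by simpa using congrArg Fin.val h
        have h3 : (j : ℕ) + 1 = i := by simpa using congrArg Fin.val hj
        omega
      have hz : weight (0 : Params n) j = 0 := rfl
      have hj1 : belowFst 0 Δ j.succ = 0 := by
        rw [belowFst_succ, below_zero_param hj0, hz, Matrix.zero_mul, Matrix.mul_zero, add_zero]
      have hi1 : belowFst 0 Δ i.castSucc = 0 := hj ▸ hj1
      rw [hi1, Matrix.mul_zero]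
    · rw [above_zero_param hi, Matrix.zero_mul, Matrix.zero_mul]
  rw [hessForm, h1, h2, frob_zero_right, frob_zero_right, mul_zero, add_zero]

theorem hessForm_one {n : Fin 2 → ℕ} (R : Matrix (Fin (n (Fin.last 1))) (Fin (n 0)) ℝ)
    (θ Δ : Params n) : hessForm R θ Δ = ‖Δ‖ ^ 2 := by
  have h1 : belowFst θ Δ (Fin.last 1) = weight Δ 0 := by
    have h : belowFst θ Δ (0 : Fin 1).succ =
        weight θ 0 * (0 : Matrix (Fin (n (0 : Fin 1).castSucc)) (Fin (n 0)) ℝ) +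
          weight Δ 0 * below θ (0 : Fin 1).castSucc := rfl
    rw [Matrix.mul_zero, zero_add] at h
    exact h.trans (Matrix.mul_one _)
  have h2 : belowSnd θ Δ (Fin.last 1) = 0 := by
    have h : belowSnd θ Δ (0 : Fin 1).succ =
        weight θ 0 * (0 : Matrix (Fin (n (0 : Fin 1).castSucc)) (Fin (n 0)) ℝ) +
          weight Δ 0 * (0 : Matrix (Fin (n (0 : Fin 1).castSucc)) (Fin (n 0)) ℝ) := rfl
    rw [Matrix.mul_zero, Matrix.mul_zero, add_zero] at h
    exact h
  rw [hessForm, h1, h2, frob_zero_right, mul_zero, add_zero, norm_sq_eq_sum_frob, Fin.sum_univ_one]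

section TwoLayers

variable {n : Fin 3 → ℕ}

/-- The first weight matrix of a network with two layers. -/
def weightFst (θ : Params n) : Matrix (Fin (n 1)) (Fin (n 0)) ℝ := weight θ 0

/-- The second weight matrix of a network with two layers. -/
def weightSnd (θ : Params n) : Matrix (Fin (n (Fin.last 2))) (Fin (n 1)) ℝ := weight θ 1

/-- The network with two given layers. -/
def ofPair (A : Matrix (Fin (n 1)) (Fin (n 0)) ℝ) (B : Matrix (Fin (n (Fin.last 2))) (Fin (n 1)) ℝ) :
    Params n :=
  ofWeights fun j => match j with
    | 0 => A
    | 1 => B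

theorem inner_twoLayer (θ θ' : Params n) : ⟪θ, θ'⟫ =
    frob (weightFst θ) (weightFst θ') + frob (weightSnd θ) (weightSnd θ') := by
  rw [inner_eq_sum_frob, Fin.sum_univ_two]
  rfl

theorem hessForm_twoLayer (R : Matrix (Fin (n (Fin.last 2))) (Fin (n 0)) ℝ) (θ Δ : Params n) :
    hessForm R θ Δ =
      twoLayerForm R (weightFst θ) (weightSnd θ) (weightFst Δ) (weightSnd Δ) := by
  have hb : below θ (1 : Fin 3) = weightFst θ := Matrix.mul_one (weightFst θ)
  have h0 : network θ = weightSnd θ * weightFst θ := by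
    rw [← hb]; rfl
  have hd : belowFst θ Δ (1 : Fin 3) = weightFst Δ := by
    have h : belowFst θ Δ (1 : Fin 3) =
        weightFst θ * (0 : Matrix (Fin (n 0)) (Fin (n 0)) ℝ) +
          weightFst Δ * (1 : Matrix (Fin (n 0)) (Fin (n 0)) ℝ) := rfl
    rwa [Matrix.mul_zero, zero_add, Matrix.mul_one] at h
  have h1 : belowFst θ Δ (Fin.last 2) =
      weightSnd θ * weightFst Δ + weightSnd Δ * weightFst θ := by
    rw [← hb, ← hd]; rfl
  have hs : belowSnd θ Δ (1 : Fin 3) = 0 := by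
    have h : belowSnd θ Δ (1 : Fin 3) = weightFst θ * (0 : Matrix (Fin (n 0)) (Fin (n 0)) ℝ) +
        weightFst Δ * (0 : Matrix (Fin (n 0)) (Fin (n 0)) ℝ) := rfl
    rwa [Matrix.mul_zero, Matrix.mul_zero, add_zero] at h
  have h2 : belowSnd θ Δ (Fin.last 2) = weightSnd Δ * weightFst Δ := by
    have h : belowSnd θ Δ (Fin.last 2) = weightSnd θ * belowSnd θ Δ (1 : Fin 3) +
      weightSnd Δ * belowFst θ Δ (1 : Fin 3) := rfl
    rwa [hs, hd, Matrix.mul_zero, zero_add] at h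
  rw [hessForm, h0, h1, h2]
  rfl

end TwoLayers

/-- The Hessian of the loss does not have the eigenvalue `1 / δ` everywhere. -/
theorem exists_nondegenerate {L N : ℕ} {n : Fin (L + 1) → ℕ}
    {R : Matrix (Fin (n (Fin.last L))) (Fin (n 0)) ℝ} {x : Fin N → EuclideanSpace ℝ (Fin (n 0))}
    (hx : (1 / (N : ℝ)) • ∑ i, Matrix.vecMulVec (x i) (x i) = 1) (hL : 0 < L) {δ : ℝ}
    (hδ : 0 < δ) (hδL : L = 1 → δ ≠ 1) :
    ∃ a : Params n, ∀ Δ, Δ = δ • fderiv ℝ (gradient (loss R x)) a Δ → Δ = 0 := by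
  have hquad : ∀ a Δ : Params n, Δ = δ • fderiv ℝ (gradient (loss R x)) a Δ →
      ‖Δ‖ ^ 2 = δ * hessForm R a Δ := by
    intro a Δ h
    rw [← (loss_variations hx a Δ).2, ← real_inner_smul_left, ← h, real_inner_self_eq_norm_sq]
  have hbil : ∀ a Δ : Params n, Δ = δ • fderiv ℝ (gradient (loss R x)) a Δ → ∀ Δ',
      2 * ⟪Δ, Δ'⟫ = δ * (hessForm R a (Δ + Δ') - hessForm R a Δ - hessForm R a Δ') := by
    intro a Δ h Δ'
    have h1 : ⟪Δ, Δ'⟫ = δ * ⟪fderiv ℝ (gradient (loss R x)) a Δ, Δ'⟫ := by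
      rw [← real_inner_smul_left, ← h]
    rw [h1, ← (loss_variations hx a Δ).2, ← (loss_variations hx a Δ').2,
      ← (loss_variations hx a (Δ + Δ')).2, map_add, inner_add_left, inner_add_right,
      inner_add_right, inner_fderiv_gradient_symm (contDiff_loss hx) a Δ' Δ,
      real_inner_comm (fderiv ℝ (gradient (loss R x)) a Δ) Δ']
    ring
  have hzero : ∀ Δ : Params n, ‖Δ‖ ^ 2 = 0 → Δ = 0 := fun Δ h => by simpa using h
  obtain rfl | rfl | hL3 : L = 1 ∨ L = 2 ∨ 3 ≤ L := by omega
  · refine ⟨0, fun Δ h => hzero Δ ?_⟩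
    have h1 := hquad 0 Δ h
    rw [hessForm_one] at h1
    have h2 : (1 - δ) * ‖Δ‖ ^ 2 = 0 := by linarith
    exact (mul_eq_zero.1 h2).resolve_left (sub_ne_zero.2 (hδL rfl).symm)
  · obtain ⟨W₁, W₂, hW⟩ := exists_twoLayer_nondegenerate (q := n 1) R hδ
    refine ⟨ofPair W₁ W₂, fun Δ h => hzero Δ ?_⟩
    rw [← real_inner_self_eq_norm_sq, inner_twoLayer]
    refine hW _ _ (fun D₁ D₂ => ?_) ?_
    · have h1 := hbil _ Δ h (ofPair D₁ D₂)
      rw [inner_twoLayer, hessForm_twoLayer, hessForm_twoLayer, hessForm_twoLayer] at h1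
      exact h1
    · have h1 := hquad _ Δ h
      rw [← real_inner_self_eq_norm_sq, inner_twoLayer, hessForm_twoLayer] at h1
      exact h1
  · refine ⟨0, fun Δ h => hzero Δ ?_⟩
    rw [hquad 0 Δ h, hessForm_zero_of_three_le hL3, mul_zero]

end Nondegenerate

/-! ### Assembling the bound -/

section Conclusion

theorem eq_zero_of_singularValues_zero {a b : ℕ} {A : Matrix (Fin a) (Fin b) ℝ}
    (h : (Matrix.toEuclideanLin A).singularValues 0 = 0) : A = 0 := by
  rw [LinearMap.singularValues_eq_zero_iff_le_finrank_range, nonpos_iff_eq_zero,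
    Submodule.finrank_eq_zero, LinearMap.range_eq_bot] at h
  simpa using h

theorem sharpnessSum_one {n : Fin 2 → ℕ} (θ : Params n) {u : EuclideanSpace ℝ (Fin (n (Fin.last 1)))}
    {v : EuclideanSpace ℝ (Fin (n 0))} (hu : ‖u‖ = 1) (hv : ‖v‖ = 1) :
    sharpnessSum θ u v = 1 := by
  have h1 : pNorm θ v 0 = 1 := by
    rw [pNorm, below_zero, ← hv]; simp
  have h2 : qNorm θ u (Fin.last 1) = 1 := by
    rw [qNorm, above_last, ← hu]; simp
  have h : sharpnessSum θ u v = pNorm θ v 0 ^ 2 * qNorm θ u (Fin.last 1) ^ 2 := by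
    rw [sharpnessSum, Fin.sum_univ_one]; rfl
  rw [h, h1, h2]; norm_num

/-- At a critical point with positive semidefinite Hessian, the Hessian attains at least the
square of `sharpnessSum` in the steepest direction of a top singular pair. -/
theorem sharpnessSum_sq_le_hessForm {L : ℕ} {n : Fin (L + 1) → ℕ} (hL : 0 < L)
    {R : Matrix (Fin (n (Fin.last L))) (Fin (n 0)) ℝ} {θ : Params n}
    (hcrit : ∀ Δ, frob (network θ - R) (belowFst θ Δ (Fin.last L)) = 0)
    (hpsd : ∀ Δ, 0 ≤ hessForm R θ Δ) {u : EuclideanSpace ℝ (Fin (n (Fin.last L)))}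
    {v : EuclideanSpace ℝ (Fin (n 0))} (huv : IsTopSingularPair (network θ) u v) :
    sharpnessSum θ u v ^ 2 ≤ hessForm R θ (steepDir θ u.ofLp v.ofLp) := by
  obtain ⟨hu, hv, h1, h2⟩ := huv
  have hu' : u.ofLp ⬝ᵥ u.ofLp = 1 := by rw [← norm_sq_eq_dotProduct, hu, one_pow]
  have hv' : v.ofLp ⬝ᵥ v.ofLp = 1 := by rw [← norm_sq_eq_dotProduct, hv, one_pow]
  rw [← frob_belowFst_steepDir]
  rcases (LinearMap.singularValues_nonneg (Matrix.toEuclideanLin (network θ)) 0).eq_or_lt with h | h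
  · exact sq_le_hessForm_of_network_eq_zero (eq_zero_of_singularValues_zero h.symm) hpsd hu' hv'
  · exact sq_le_hessForm_of_pos hL hcrit hpsd h hu' hv' (congrArg WithLp.ofLp h1)
      (congrArg WithLp.ofLp h2) _

end Conclusion

end DeepLinear

theorem theorem1 {L N : ℕ} (n : Fin (L + 1) → ℕ)
    (R : Matrix (Fin (n (Fin.last L))) (Fin (n 0)) ℝ) (hR : R ≠ 0)
    (x : Fin N → EuclideanSpace ℝ (Fin (n 0)))
    (hx : (1 / (N : ℝ)) • ∑ i, Matrix.vecMulVec (x i) (x i) = 1)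
    (δ : ℝ) (hδ : 0 < δ)
    (μ : Measure (DeepLinear.Params n)) [IsProbabilityMeasure μ] (hμ : μ ≪ volume) :
    ∀ᵐ θ₀ ∂μ, ∀ θ : DeepLinear.Params n,
      Tendsto (DeepLinear.gradientDescent (DeepLinear.loss R x) δ θ₀) atTop (𝓝 θ) →
      ∀ u v, DeepLinear.IsTopSingularPair (DeepLinear.network θ) u v →
        0 < DeepLinear.sharpnessSum θ u v →
          δ ≤ 2 / DeepLinear.sharpnessSum θ u v := by
  rcases Nat.eq_zero_or_pos L with rfl | hL
  · refine Eventually.of_forall fun _ _ _ _ _ _ hS => absurd hS ?_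
    simp [DeepLinear.sharpnessSum]
  -- Here the gradient step is constant, so its Jacobian vanishes identically; but the sum is `1`
  -- and the bound reads `1 ≤ 2`.
  by_cases h1 : L = 1 ∧ δ = 1
  · obtain ⟨rfl, rfl⟩ := h1
    refine Eventually.of_forall fun _ θ _ u v huv _ => ?_
    rw [DeepLinear.sharpnessSum_one θ huv.1 huv.2.1]
    norm_num
  obtain ⟨a, ha⟩ := DeepLinear.exists_nondegenerate hx hL hδ fun h h' => h1 ⟨h, h'⟩
  filter_upwards [hμ.ae_le (DeepLinear.ae_limit_gradientDescent volume
    (DeepLinear.contDiff_loss hx) hδ ha)] with θ₀ hθ₀ θ hθ u v huv hS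
  obtain ⟨hgrad, hhess⟩ := hθ₀ θ hθ
  have hcrit : ∀ Δ, DeepLinear.frob (DeepLinear.network θ - R)
      (DeepLinear.belowFst θ Δ (Fin.last L)) = 0 := fun Δ => by
    rw [← (DeepLinear.loss_variations hx θ Δ).1, hgrad, inner_zero_left]
  have hform := fun Δ => (DeepLinear.loss_variations (R := R) hx θ Δ).2
  have hpsd : ∀ Δ, 0 ≤ DeepLinear.hessForm R θ Δ := fun Δ => by
    rw [← hform]; exact (hhess Δ).1
  -- With `S` the sum, this and the next bound give `δ S² ≤ δ ⟪HT, T⟫ ≤ 2 ‖T‖² = 2 S`.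
  have hle := DeepLinear.sharpnessSum_sq_le_hessForm hL hcrit hpsd huv
  have hub := (hhess (DeepLinear.steepDir θ u.ofLp v.ofLp)).2
  rw [hform, DeepLinear.norm_sq_steepDir] at hub
  rw [le_div_iff₀ hS]
  have := mul_le_mul_of_nonneg_left hle hδ.le
  nlinarith
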